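/- **Setting.** Let $A\in\mathbb{R}_{\ge 0}^{n_d\times n_p}$, $b\in\mathbb{R}_{\ge0}^{n_d}$, $c\in\mathbb{R}_{\ge0}^{n_p}$, and consider the covering LP (P): $\min c^{T}x$ subject to $Ax\ge b$, $x\ge0$, and its dual packing LP (D): $\max b^{T}y$ subject to $A^{T}y\le c$, $y\ge 0$. Assume that (P) is feasible. The network $G$ is the bipartite graph with one node $v^p_i$ per primal variable, one node $v^d_j$ per dual variable, and an edge $\{v_i^p,v_j^d\}$ whenever $a_{ji}\neq0$. Nodes have distinct identifiers from a linearly ordered set. Initially $v_i^p$ knows its identifier, $c_i$ and the $i$-th column of $A$, and $v_j^d$ knows its identifier, $b_j$ and the $j$-th row of $A$ (coefficients being listed by neighbour identifiers). Communication is by synchronous rounds in the LOCAL model (unbounded messages and local computation). Let $\mathcal{G}$ be the graph on the dual nodes in which two distinct nodes are adjacent iff their distance in $G$ is at most $4$. **Linial–Saks procedure $LS(p,R)$ on $\mathcal G$** ($p\in[0,1]$, integer $R\ge1$). Every node $w$ independently draws a radius $r_w\in\{0,\dots,R\}$ with $\Pr[r_w=k]=p^k(1-p)$ for $k<R$ and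 $\Pr[r_w=R]=p^R$. The leader $\ell(u)$ of a node $u$ is the node of highest identifier among all $w$ with $d_{\mathcal G}(u,w)\le r_w$. The computed set is $\mathcal S=\{u: d_{\mathcal G}(u,\ell(u))<r_{\ell(u)}\}$. **Algorithm** (parameters $\ell,p,R$). 1. Run $\ell$ independent instances of $LS(p,R)$ on $\mathcal G$, which give sets $\mathcal S_1,\dots,\mathcal S_\ell$ of dual nodes. 2. For every $t$ compute optimal solutions $x_t$, $y_t$ (any) of $P_{\mathcal S_t}$ and $D_{\mathcal S_t}$. Here $P_S$ is (P) restricted to the inequalities in $S$ and to the variables occurring in them, $D_S$ is the dual of $P_S$, and solutions are extended by $0$. 3. Put $x=\sum_t x_t$ and $y=\sum_t y_t$. 4. Simultaneously replace every $x_i$ by $x_i\big/\min_{j:\,a_{ji}\ne0}\frac{(Ax)_j}{b_j}$, where inequalities with $b_j=0$ count as $+\infty$ and $x_i/(+\infty)=0$, and every $y_j$ by $y_j/\ell$. Return $(x,y)$. **Theorem.** 1. There is a universal constant $C$ such that for all $\ell$ and $R\ge1$ the algorithm can be executed, on every network as above, in $C\cdot R=O(R)$ rounds of the LOCAL model. That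 is, some LOCAL algorithm, which depends only on $\ell$, $R$ and the identifier space, outputs after $C\cdot R$ rounds, for every outcome of the random radii, a result of the algorithm above, each node outputting the value of its variable. 2. Let $\varepsilon\in(0,1)$, $\alpha>1$, $\beta>0$, $n_d\ge2$, $p=n_d^{-\alpha/R}$, $q=p(1-n_dp^R)$ and $\ell\ge\frac{2(1+\beta)}{\varepsilon^2q}\ln n_d$. Then, with probability at least $1-n_d^{-\beta}$ over the radii, every result $(x,y)$ of the algorithm (whichever optimal solutions are used in step 2) is feasible for (P) and (D), and $$c^{T}x\le\frac{1}{q(1-\varepsilon)}\,c^{T}x'\qquad\text{and}\qquad b^{T}y'\le\frac1{q(1-\varepsilon)}\,b^{T}y$$ for all feasible $x'$ of (P) and $y'$ of (D). So $x$ and $y$ are $\frac1{q(1-\varepsilon)}$-approximate solutions. -/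

import Mathlib

open scoped Classical
open MeasureTheory

noncomputable section

/-! ## The LOCAL model: synchronous message passing -/

/-- A deterministic distributed algorithm for networks whose nodes carry identifiers from `ID`, local
inputs from `I` and outputs in `O`.  For a randomized algorithm, the random choices of a node
are part of its local input.  Messages and local computations are unrestricted.
`init a i` is the initial state of a node with identifier `a` and input `i`,
`send s a` is the message that a node in state `s` sends to its neighbour with identifier `a`,
`step s M` is the new state after receiving the set `M` of (sender, message) pairs. -/
structure LocalAlgorithm (ID I O : Type) where
  State : Type
  Msg : Type
  init : ID → I → State
  send : State → ID → Msg
  step : State → Set (ID × Msg) → State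
  out : State → O

/-- The state of node `v` after the given number of synchronous rounds on the network `G`. -/
def LocalAlgorithm.state {ID I O V : Type} (𝒜 : LocalAlgorithm ID I O) (G : SimpleGraph V)
    (ident : V → ID) (inp : V → I) : ℕ → V → 𝒜.State
  | 0, v => 𝒜.init (ident v) (inp v)
  | T + 1, v => 𝒜.step (𝒜.state G ident inp T v)
      {m | ∃ u, G.Adj v u ∧ m = (ident u, 𝒜.send (𝒜.state G ident inp T u) (ident v))}

/-- The output of node `v` when all nodes stop after `T` rounds. -/
def LocalAlgorithm.output {ID I O V : Type} (𝒜 : LocalAlgorithm ID I O) (G : SimpleGraph V)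
    (ident : V → ID) (inp : V → I) (T : ℕ) (v : V) : O :=
  𝒜.out (𝒜.state G ident inp T v)

/-! ## The Linial–Saks procedure -/

/-- The truncated geometric distribution on `{0, …, R}`: the probability of `k` is
`p ^ k * (1 - p)` for `k < R`, and that of `R` is `p ^ R`. -/
def radiusPMF (p : unitInterval) (R : ℕ) : PMF (Fin (R + 1)) :=
  PMF.ofFintype
    (fun k => ENNReal.ofReal (if (k : ℕ) < R then (p : ℝ) ^ (k : ℕ) * (1 - p) else (p : ℝ) ^ R))
    (by
      have h0 : (0 : ℝ) ≤ p := p.2.1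
      have h1 : (0 : ℝ) ≤ 1 - p := sub_nonneg.2 p.2.2
      rw [← ENNReal.ofReal_sum_of_nonneg]
      · rw [Fin.sum_univ_castSucc]
        simp only [Fin.val_castSucc, Fin.is_lt, if_true, Fin.val_last, lt_irrefl, if_false]
        rw [← Finset.sum_mul, Fin.sum_univ_eq_sum_range (fun k => (p : ℝ) ^ k) R,
          geom_sum_mul_neg]
        simp
      · intro k _
        split_ifs <;> positivity)

/-- The law of the radii drawn in `ℓ` runs on the node set `V`: all radii, over all runs and
all nodes, are independent with the truncated geometric distribution. -/
def radiiMeasure (p : unitInterval) (R ℓ : ℕ) (V : Type) [Fintype V] :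
    Measure (Fin ℓ → V → Fin (R + 1)) :=
  Measure.pi fun _ => Measure.pi fun _ => (radiusPMF p R).toMeasure

/-- Every node `w` broadcasts its identifier up to distance `r w`; the leader of `u` is the node
with the highest identifier among all nodes (including `u`) whose broadcast reaches `u`. -/
def IsLeader {V ID : Type} [LinearOrder ID] (G : SimpleGraph V) (ident : V → ID) (r : V → ℕ)
    (v u : V) : Prop :=
  G.edist u v ≤ r v ∧ ∀ w, G.edist u w ≤ r w → ident w ≤ ident v

/-- The set computed by the Linial–Saks procedure from the radii `r`: a node joins it if its
distance to its leader is strictly smaller than the radius of the leader. -/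
def linialSaks {V ID : Type} [LinearOrder ID] (G : SimpleGraph V) (ident : V → ID) (r : V → ℕ) :
    Set V :=
  {u | ∃ v, IsLeader G ident r v u ∧ G.edist u v < r v}

/-! ## Covering and packing linear programs -/

/-- The common data of the covering LP (P) `min cᵀx, A x ≥ b, x ≥ 0` and of its dual, the packing LP
(D) `max bᵀy, Aᵀy ≤ c, y ≥ 0`. Columns of `A` (primal variables) are indexed by `Vp`, rows
(dual variables) by `Vd`, and all coefficients are non-negative. -/
structure CoveringLP (Vp Vd : Type) where
  A : Matrix Vd Vp ℝ
  b : Vd → ℝ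
  c : Vp → ℝ
  A_nonneg : ∀ j i, 0 ≤ A j i
  b_nonneg : ∀ j, 0 ≤ b j
  c_nonneg : ∀ i, 0 ≤ c i

namespace CoveringLP

variable {Vp Vd : Type} [Fintype Vp] [Fintype Vd] (L : CoveringLP Vp Vd)

/-- The objective function of (P). -/
def primalValue (x : Vp → ℝ) : ℝ := ∑ i, L.c i * x i

/-- The objective function of (D). -/
def dualValue (y : Vd → ℝ) : ℝ := ∑ j, L.b j * y j

/-- Feasible solutions of (P). -/
def PrimalFeasible (x : Vp → ℝ) : Prop :=
  (∀ i, 0 ≤ x i) ∧ ∀ j, L.b j ≤ ∑ i, L.A j i * x i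

/-- Feasible solutions of (D). -/
def DualFeasible (y : Vd → ℝ) : Prop :=
  (∀ j, 0 ≤ y j) ∧ ∀ i, ∑ j, L.A j i * y j ≤ L.c i

/-- Feasible solutions of (P) that are within a factor `ρ` of every feasible solution. -/
def IsPrimalApprox (ρ : ℝ) (x : Vp → ℝ) : Prop :=
  L.PrimalFeasible x ∧ ∀ x', L.PrimalFeasible x' → L.primalValue x ≤ ρ * L.primalValue x'

/-- Feasible solutions of (D) that are within a factor `ρ` of every feasible solution. -/
def IsDualApprox (ρ : ℝ) (y : Vd → ℝ) : Prop :=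
  L.DualFeasible y ∧ ∀ y', L.DualFeasible y' → L.dualValue y' ≤ ρ * L.dualValue y

/-- The primal variables of the sub-LP of a set `S` of rows: those that occur in a row of `S`. -/
def subVars (S : Set Vd) : Set Vp := {i | ∃ j ∈ S, L.A j i ≠ 0}

/-- Feasible solutions of `P_S`, the restriction of (P) to the inequalities in `S`,
extended by `0` to all primal variables. -/
def SubPrimalFeasible (S : Set Vd) (x : Vp → ℝ) : Prop :=
  (∀ i, 0 ≤ x i) ∧ (∀ i, i ∉ L.subVars S → x i = 0) ∧ ∀ j ∈ S, L.b j ≤ ∑ i, L.A j i * x i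

/-- Feasible solutions of `D_S`, the dual of `P_S`, extended by `0` to all dual variables. -/
def SubDualFeasible (S : Set Vd) (y : Vd → ℝ) : Prop :=
  (∀ j, 0 ≤ y j) ∧ (∀ j, j ∉ S → y j = 0) ∧ ∀ i ∈ L.subVars S, ∑ j, L.A j i * y j ≤ L.c i

/-- Optimal solutions of `P_S`. -/
def SubPrimalOptimal (S : Set Vd) (x : Vp → ℝ) : Prop :=
  L.SubPrimalFeasible S x ∧ ∀ x', L.SubPrimalFeasible S x' → L.primalValue x ≤ L.primalValue x'

/-- Optimal solutions of `D_S`. -/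
def SubDualOptimal (S : Set Vd) (y : Vd → ℝ) : Prop :=
  L.SubDualFeasible S y ∧ ∀ y', L.SubDualFeasible S y' → L.dualValue y' ≤ L.dualValue y

end CoveringLP

/-! ## The network of a linear program and the algorithm -/

namespace CoveringLP

/-- The bipartite network graph of the linear program. -/
def network {Vp Vd : Type} (L : CoveringLP Vp Vd) : SimpleGraph (Vp ⊕ Vd) where
  Adj u v := (∃ i j, L.A j i ≠ 0 ∧ u = Sum.inl i ∧ v = Sum.inr j) ∨
    (∃ i j, L.A j i ≠ 0 ∧ u = Sum.inr j ∧ v = Sum.inl i)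
  symm := ⟨by
    rintro u v (⟨i, j, h, hu, hv⟩ | ⟨i, j, h, hu, hv⟩)
    · exact Or.inr ⟨i, j, h, hv, hu⟩
    · exact Or.inl ⟨i, j, h, hv, hu⟩⟩
  loopless := ⟨by
    rintro u (⟨i, j, -, hu, hv⟩ | ⟨i, j, -, hu, hv⟩) <;> simp [hu] at hv⟩

/-- The graph on the dual nodes in which two distinct nodes are adjacent if their distance
in the network is at most `4`. -/
def clusterGraph {Vp Vd : Type} (L : CoveringLP Vp Vd) : SimpleGraph Vd where
  Adj u v := u ≠ v ∧ L.network.edist (Sum.inr u) (Sum.inr v) ≤ 4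
  symm := ⟨by
    rintro u v ⟨h, h'⟩
    exact ⟨h.symm, by rwa [SimpleGraph.edist_comm]⟩⟩
  loopless := ⟨fun _ h => h.1 rfl⟩

/-- The set `𝒮 t` computed by the `t`-th Linial–Saks run. -/
def lsSet {Vp Vd ID : Type} [LinearOrder ID] (L : CoveringLP Vp Vd) (ident : Vp ⊕ Vd → ID)
    {R ℓ : ℕ} (r : Fin ℓ → Vd → Fin (R + 1)) (t : Fin ℓ) : Set Vd :=
  linialSaks L.clusterGraph (fun j => ident (Sum.inr j)) (fun j => (r t j : ℕ))

variable {Vp Vd : Type} [Fintype Vp] [Fintype Vd] (L : CoveringLP Vp Vd)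

/-- The non-trivial inequalities (those with `b j > 0`) in which the variable `i` occurs. -/
def rowsOf (i : Vp) : Finset Vd := Finset.univ.filter fun j => L.A j i ≠ 0 ∧ 0 < L.b j

/-- The rescaling `x i / min_j (A x)_j / b_j`, where `j` ranges over the inequalities containing
variable `i`.  An inequality with `b j = 0` counts as `(A x)_j / b_j = +∞`; so if there is no
other inequality, the result is `0`. -/
def rescale (x : Vp → ℝ) (i : Vp) : ℝ :=
  if h : (L.rowsOf i).Nonempty then
    x i / (L.rowsOf i).inf' h (fun j => (∑ k, L.A j k * x k) / L.b j)
  else 0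

/-- `(x, y)` is a possible result of the algorithm if the radii drawn in the `ℓ` Linial–Saks runs
are `r`: optimal solutions `xs t`, `ys t` of the sub-LPs of the sets `𝒮 t` are added up, the
primal sum is rescaled, and the dual sum is divided by `ℓ`.  Any optimal solutions of the
sub-LPs may be used. -/
def IsAlgorithmResult {ID : Type} [LinearOrder ID] (ident : Vp ⊕ Vd → ID)
    {R ℓ : ℕ} (r : Fin ℓ → Vd → Fin (R + 1)) (x : Vp → ℝ) (y : Vd → ℝ) : Prop :=
  ∃ (xs : Fin ℓ → Vp → ℝ) (ys : Fin ℓ → Vd → ℝ),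
    (∀ t, L.SubPrimalOptimal (L.lsSet ident r t) (xs t)) ∧
    (∀ t, L.SubDualOptimal (L.lsSet ident r t) (ys t)) ∧
    (∀ i, x i = L.rescale (fun k => ∑ t, xs t k) i) ∧
    (∀ j, y j = (∑ t, ys t j) / ℓ)

end CoveringLP

/-- What a node of the network knows initially, besides its identifier and the parameters: a primal
node knows its cost and its column of `A`, a dual node knows its right-hand side, its row of `A`
and the radii it has drawn in the `ℓ` runs.  The entries of the column or row are listed by
the identifiers of the neighbours; they are `0` at all other identifiers. -/
inductive NodeInput (ID : Type) (R ℓ : ℕ) : Type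
  | primal (cost : ℝ) (column : ID → ℝ) : NodeInput ID R ℓ
  | dual (rhs : ℝ) (row : ID → ℝ) (radii : Fin ℓ → Fin (R + 1)) : NodeInput ID R ℓ

/-- The initial knowledge of the nodes in the network of `L`. -/
def CoveringLP.nodeInput {Vp Vd ID : Type} (L : CoveringLP Vp Vd) (ident : Vp ⊕ Vd → ID)
    {R ℓ : ℕ} (r : Fin ℓ → Vd → Fin (R + 1)) : Vp ⊕ Vd → NodeInput ID R ℓ
  | Sum.inl i => .primal (L.c i)
      (Function.extend (fun j => ident (Sum.inr j)) (fun j => L.A j i) fun _ => 0)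
  | Sum.inr j => .dual (L.b j)
      (Function.extend (fun i => ident (Sum.inl i)) (fun i => L.A j i) fun _ => 0)
      (fun t => r t j)

end

/-!
The quality of the result rests on coverage counts only.  If every row lies in at least `κ * ℓ` of
the sets `𝒮 t`, then `∑ t, xs t` covers every row `κ * ℓ` times, so that the rescaling divides it
by at least `κ * ℓ`, while each `xs t` costs at most as much as any feasible `x'`, whose
restriction is feasible for `P_{𝒮 t}`.  Dually, `ys t` is feasible for (D) and at least as good as
the restriction of any feasible `y'` to `𝒮 t`; summation over `t` counts every row `κ * ℓ`
times.  Thus strong duality is not needed (`CoveringLP.approx_of_count`).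

For `κ = (1 - ε) * q` the counts are large enough with the required probability.  For fixed nodes
`u` and `w`, the event that `w` is the leader of `u` is a box in the product space of the radii, and
the truncated geometric distribution is memoryless below `R`.  So a node is in `𝒮 t` with
probability at least `p * (1 - n * p ^ R)` (`measureReal_mem_linialSaks_ge`).  A Chernoff bound over
the `ℓ` independent runs (`measureReal_count_lt_le`) and a union bound over the rows
finish this part.

For the distributed execution, the nodes of `𝒮 t` with a common leader form a cluster.  Distinct
clusters share no variable (`CoveringLP.cluster_leader_unique`), so that optimal solutions for the
clusters add up to optimal solutions for `𝒮 t`.  On each cluster an optimal solution is chosen from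
the set of all optimal solutions, written as functions of identifiers.  This set depends only
on the cluster, hence all nodes that know the cluster make the same choice.  The resulting
output of a node is determined by its neighbourhood of radius `15 * R`
(`CoveringLP.IsLocalPart.canonicalOutput_eq`), and a full-information algorithm, which forwards
everything it knows, learns this neighbourhood in `15 * R` rounds
(`CoveringLP.fullInformation_output`).
-/

/-! ### Optimal solutions of the sub-LPs and approximation from coverage counts -/

namespace CoveringLP

variable {Vp Vd : Type} (L : CoveringLP Vp Vd)

theorem sum_mul_indicator_subVars [Fintype Vp] {S : Set Vd} (x : Vp → ℝ) {j : Vd} (hj : j ∈ S) :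
    ∑ i, L.A j i * (L.subVars S).indicator x i = ∑ i, L.A j i * x i := by
  refine Finset.sum_congr rfl fun i _ => ?_
  by_cases hi : i ∈ L.subVars S
  · rw [Set.indicator_of_mem hi]
  · have : L.A j i = 0 := by
      by_contra h
      exact hi ⟨j, hj, h⟩
    simp [this]

theorem subPrimalFeasible_indicator [Fintype Vp] {S : Set Vd} {x : Vp → ℝ} (h0 : ∀ i, 0 ≤ x i)
    (h1 : ∀ j ∈ S, L.b j ≤ ∑ i, L.A j i * x i) :
    L.SubPrimalFeasible S ((L.subVars S).indicator x) := by
  refine ⟨fun i => Set.indicator_nonneg (fun i _ => h0 i) i,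
    fun i hi => Set.indicator_of_notMem hi x, fun j hj => ?_⟩
  rw [L.sum_mul_indicator_subVars x hj]
  exact h1 j hj

theorem subDualFeasible_indicator [Fintype Vd] {S : Set Vd} {y : Vd → ℝ} (h0 : ∀ j, 0 ≤ y j)
    (h1 : ∀ i ∈ L.subVars S, ∑ j, L.A j i * y j ≤ L.c i) :
    L.SubDualFeasible S (S.indicator y) := by
  refine ⟨fun j => Set.indicator_nonneg (fun j _ => h0 j) j,
    fun j hj => Set.indicator_of_notMem hj y, fun i hi => le_trans ?_ (h1 i hi)⟩
  exact Finset.sum_le_sum fun j _ => mul_le_mul_of_nonneg_left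
    (Set.indicator_le_self' (fun j _ => h0 j) j) (L.A_nonneg j i)

theorem subVars_mono {S S' : Set Vd} (h : S ⊆ S') : L.subVars S ⊆ L.subVars S' := by
  rintro i ⟨j, hj, hA⟩
  exact ⟨j, h hj, hA⟩

/-- No coordinate `x i` has to exceed `∑ j, b j / A j i`, because at that value the variable alone
satisfies every inequality it occurs in.  So the minimum may be taken over a compact box. -/
theorem exists_subPrimalOptimal [Fintype Vp] [Fintype Vd] {S : Set Vd}
    (h : ∃ x, L.SubPrimalFeasible S x) :
    ∃ x, L.SubPrimalOptimal S x := by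
  set M : Vp → ℝ := fun i => ∑ j, L.b j / L.A j i with hM
  have hM0 : ∀ i, 0 ≤ M i := fun i =>
    Finset.sum_nonneg fun j _ => div_nonneg (L.b_nonneg j) (L.A_nonneg j i)
  have hMle : ∀ j i, L.A j i ≠ 0 → L.b j ≤ L.A j i * M i := by
    intro j i hA
    have h1 : L.b j / L.A j i ≤ M i :=
      Finset.single_le_sum (f := fun j => L.b j / L.A j i)
        (fun j _ => div_nonneg (L.b_nonneg j) (L.A_nonneg j i)) (Finset.mem_univ j)
    have h2 : 0 < L.A j i := lt_of_le_of_ne (L.A_nonneg j i) (Ne.symm hA)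
    rw [div_le_iff₀ h2] at h1
    linarith
  have hcap : ∀ x, L.SubPrimalFeasible S x →
      L.SubPrimalFeasible S (fun i => min (x i) (M i)) := by
    rintro x ⟨h0, h1, h2⟩
    refine ⟨fun i => le_min (h0 i) (hM0 i), fun i hi => ?_, fun j hj => ?_⟩
    · simp only [h1 i hi]
      exact min_eq_left (hM0 i)
    · by_cases hex : ∃ i, L.A j i ≠ 0 ∧ M i < x i
      · obtain ⟨i, hA, hlt⟩ := hex
        calc L.b j ≤ L.A j i * M i := hMle j i hA
          _ = L.A j i * min (x i) (M i) := by rw [min_eq_right hlt.le]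
          _ ≤ ∑ i, L.A j i * min (x i) (M i) :=
            Finset.single_le_sum (f := fun i => L.A j i * min (x i) (M i))
              (fun i _ => mul_nonneg (L.A_nonneg j i) (le_min (h0 i) (hM0 i)))
              (Finset.mem_univ i)
      · push Not at hex
        refine (h2 j hj).trans (Finset.sum_le_sum fun i _ => ?_)
        by_cases hA : L.A j i = 0
        · simp [hA]
        · exact le_of_eq (by simp only [min_eq_left (hex i hA)])
  have hcompact : IsCompact {x | L.SubPrimalFeasible S x ∧ ∀ i, x i ≤ M i} := by
    refine (isCompact_univ_pi fun i => isCompact_Icc (a := 0) (b := M i)).of_isClosed_subset ?_ ?_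
    · simp only [SubPrimalFeasible, Set.ofPred_and, Set.ofPred_forall]
      refine IsClosed.inter (IsClosed.inter ?_ (IsClosed.inter ?_ ?_)) ?_
      · exact isClosed_iInter fun i => isClosed_le (by fun_prop) (by fun_prop)
      · exact isClosed_iInter fun i => isClosed_iInter fun _ =>
          isClosed_eq (by fun_prop) (by fun_prop)
      · exact isClosed_iInter fun i => isClosed_iInter fun _ =>
          isClosed_le (by fun_prop) (by fun_prop)
      · exact isClosed_iInter fun i => isClosed_le (by fun_prop) (by fun_prop)
    · rintro x ⟨hx, hxM⟩ i -
      exact ⟨hx.1 i, hxM i⟩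
  obtain ⟨x₀, hx₀⟩ := h
  obtain ⟨x, hx, hmin⟩ := hcompact.exists_isMinOn (f := L.primalValue)
    ⟨_, hcap x₀ hx₀, fun i => min_le_right _ _⟩
    (by unfold primalValue; fun_prop)
  refine ⟨x, hx.1, fun x' hx' => ?_⟩
  refine (isMinOn_iff.1 hmin _ ⟨hcap x' hx', fun i => min_le_right _ _⟩).trans ?_
  exact Finset.sum_le_sum fun i _ =>
    mul_le_mul_of_nonneg_left (min_le_left _ _) (L.c_nonneg i)

/-- A dual coordinate `y j` of a non-zero row is at most `∑ i, c i / A j i`; a zero row has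
`b j = 0` by feasibility of the primal, so there `y j` can be lowered to `0`.  So the maximum may
be taken over a compact box. -/
theorem exists_subDualOptimal [Fintype Vp] [Fintype Vd] {S : Set Vd}
    (h : ∃ x, L.SubPrimalFeasible S x) :
    ∃ y, L.SubDualOptimal S y := by
  obtain ⟨x₀, hx₀⟩ := h
  set M : Vd → ℝ := fun j => ∑ i, L.c i / L.A j i with hM
  have hM0 : ∀ j, 0 ≤ M j := fun j =>
    Finset.sum_nonneg fun i _ => div_nonneg (L.c_nonneg i) (L.A_nonneg j i)
  have hcap : ∀ y, L.SubDualFeasible S y →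
      L.SubDualFeasible S (fun j => min (y j) (M j)) := by
    rintro y ⟨h0, h1, h2⟩
    refine ⟨fun j => le_min (h0 j) (hM0 j), fun j hj => ?_, fun i hi => ?_⟩
    · simp only [h1 j hj]
      exact min_eq_left (hM0 j)
    · refine le_trans (Finset.sum_le_sum fun j _ => ?_) (h2 i hi)
      exact mul_le_mul_of_nonneg_left (min_le_left _ _) (L.A_nonneg j i)
  have hval : ∀ y, L.SubDualFeasible S y →
      L.dualValue y = L.dualValue (fun j => min (y j) (M j)) := by
    rintro y ⟨h0, h1, h2⟩
    refine Finset.sum_congr rfl fun j _ => ?_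
    by_cases hj : j ∈ S
    swap
    · simp only [h1 j hj, min_eq_left (hM0 j)]
    by_cases hex : ∃ i, L.A j i ≠ 0
    · obtain ⟨i, hA⟩ := hex
      have hpos : 0 < L.A j i := lt_of_le_of_ne (L.A_nonneg j i) (Ne.symm hA)
      have h3 : L.A j i * y j ≤ L.c i :=
        (Finset.single_le_sum (f := fun j => L.A j i * y j)
          (fun j _ => mul_nonneg (L.A_nonneg j i) (h0 j)) (Finset.mem_univ j)).trans
          (h2 i ⟨j, hj, hA⟩)
      have h4 : L.c i / L.A j i ≤ M j :=
        Finset.single_le_sum (f := fun i => L.c i / L.A j i)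
          (fun i _ => div_nonneg (L.c_nonneg i) (L.A_nonneg j i)) (Finset.mem_univ i)
      have h5 : y j ≤ L.c i / L.A j i := by
        rw [le_div_iff₀ hpos]
        linarith
      simp only [min_eq_left (h5.trans h4)]
    · push Not at hex
      have hb := hx₀.2.2 j hj
      simp only [hex, zero_mul, Finset.sum_const_zero] at hb
      simp [le_antisymm hb (L.b_nonneg j)]
  have hcompact : IsCompact {y | L.SubDualFeasible S y ∧ ∀ j, y j ≤ M j} := by
    refine (isCompact_univ_pi fun j => isCompact_Icc (a := 0) (b := M j)).of_isClosed_subset ?_ ?_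
    · simp only [SubDualFeasible, Set.ofPred_and, Set.ofPred_forall]
      refine IsClosed.inter (IsClosed.inter ?_ (IsClosed.inter ?_ ?_)) ?_
      · exact isClosed_iInter fun i => isClosed_le (by fun_prop) (by fun_prop)
      · exact isClosed_iInter fun i => isClosed_iInter fun _ =>
          isClosed_eq (by fun_prop) (by fun_prop)
      · exact isClosed_iInter fun i => isClosed_iInter fun _ =>
          isClosed_le (by fun_prop) (by fun_prop)
      · exact isClosed_iInter fun i => isClosed_le (by fun_prop) (by fun_prop)
    · rintro y ⟨hy, hyM⟩ j -
      exact ⟨hy.1 j, hyM j⟩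
  obtain ⟨y, hy, hmax⟩ := hcompact.exists_isMaxOn (f := L.dualValue)
    ⟨0, ⟨fun _ => le_rfl, fun _ _ => rfl, fun i _ => by simpa using L.c_nonneg i⟩, hM0⟩
    (by unfold dualValue; fun_prop)
  refine ⟨y, hy.1, fun y' hy' => ?_⟩
  rw [hval y' hy']
  exact isMaxOn_iff.1 hmax _ ⟨hcap y' hy', fun j => min_le_right _ _⟩

theorem primalValue_sum [Fintype Vp] {κ : Type} [Fintype κ] (x : κ → Vp → ℝ) :
    L.primalValue (fun i => ∑ a, x a i) = ∑ a, L.primalValue (x a) := by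
  unfold primalValue
  simp_rw [Finset.mul_sum]
  exact Finset.sum_comm

theorem dualValue_sum [Fintype Vd] {κ : Type} [Fintype κ] (y : κ → Vd → ℝ) :
    L.dualValue (fun j => ∑ a, y a j) = ∑ a, L.dualValue (y a) := by
  unfold dualValue
  simp_rw [Finset.mul_sum]
  exact Finset.sum_comm

/-- If the sets `C a` have no variables in common, then optimal solutions of the LPs `P_{C a}`
add up to an optimal solution of `P_S` for `S = ⋃ a, C a`. -/
theorem subPrimalOptimal_sum [Fintype Vp] {κ : Type} [Fintype κ]
    {C : κ → Set Vd} {S : Set Vd} (hS : ∀ j, j ∈ S ↔ ∃ a, j ∈ C a)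
    (hdisj : ∀ a a' i, i ∈ L.subVars (C a) → i ∈ L.subVars (C a') → a = a')
    {x : κ → Vp → ℝ} (hx : ∀ a, L.SubPrimalOptimal (C a) (x a)) :
    L.SubPrimalOptimal S (fun i => ∑ a, x a i) := by
  have hsub : ∀ a, C a ⊆ S := fun a j hj => (hS j).2 ⟨a, hj⟩
  refine ⟨⟨fun i => Finset.sum_nonneg fun a _ => (hx a).1.1 i, fun i hi => ?_, fun j hj => ?_⟩,
    fun x' hx' => ?_⟩
  · exact Finset.sum_eq_zero fun a _ =>
      (hx a).1.2.1 i fun h => hi (L.subVars_mono (hsub a) h)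
  · obtain ⟨a, ha⟩ := (hS j).1 hj
    refine ((hx a).1.2.2 j ha).trans (Finset.sum_le_sum fun i _ => ?_)
    exact mul_le_mul_of_nonneg_left
      (Finset.single_le_sum (f := fun a => x a i) (fun a _ => (hx a).1.1 i) (Finset.mem_univ a))
      (L.A_nonneg j i)
  · rw [L.primalValue_sum]
    calc ∑ a, L.primalValue (x a)
        ≤ ∑ a, L.primalValue ((L.subVars (C a)).indicator x') :=
          Finset.sum_le_sum fun a _ => (hx a).2 _
            (L.subPrimalFeasible_indicator hx'.1 fun j hj => hx'.2.2 j (hsub a hj))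
      _ = L.primalValue (fun i => ∑ a, (L.subVars (C a)).indicator x' i) :=
          (L.primalValue_sum _).symm
      _ ≤ L.primalValue x' := by
          refine Finset.sum_le_sum fun i _ => mul_le_mul_of_nonneg_left ?_ (L.c_nonneg i)
          beta_reduce
          by_cases hex : ∃ a, i ∈ L.subVars (C a)
          · obtain ⟨a, ha⟩ := hex
            rw [Finset.sum_eq_single a, Set.indicator_of_mem ha]
            · exact fun a' _ hne => Set.indicator_of_notMem (fun h => hne (hdisj _ _ i h ha)) _
            · simp
          · rw [Finset.sum_eq_zero]
            · exact hx'.1 i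
            · exact fun a _ => Set.indicator_of_notMem (fun h => hex ⟨a, h⟩) _

theorem subDualOptimal_sum [Fintype Vp] [Fintype Vd] {κ : Type} [Fintype κ]
    {C : κ → Set Vd} {S : Set Vd} (hS : ∀ j, j ∈ S ↔ ∃ a, j ∈ C a)
    (hdisj : ∀ a a' i, i ∈ L.subVars (C a) → i ∈ L.subVars (C a') → a = a')
    (hdisj' : ∀ a a' j, j ∈ C a → j ∈ C a' → a = a')
    {y : κ → Vd → ℝ} (hy : ∀ a, L.SubDualOptimal (C a) (y a)) :
    L.SubDualOptimal S (fun j => ∑ a, y a j) := by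
  have hsub : ∀ a, C a ⊆ S := fun a j hj => (hS j).2 ⟨a, hj⟩
  refine ⟨⟨fun j => Finset.sum_nonneg fun a _ => (hy a).1.1 j, fun j hj => ?_, fun i hi => ?_⟩,
    fun y' hy' => ?_⟩
  · exact Finset.sum_eq_zero fun a _ => (hy a).1.2.1 j fun h => hj (hsub a h)
  · obtain ⟨j₀, hj₀, hA⟩ := hi
    obtain ⟨a, ha⟩ := (hS j₀).1 hj₀
    have hia : i ∈ L.subVars (C a) := ⟨j₀, ha, hA⟩
    refine le_trans (le_of_eq (Finset.sum_congr rfl fun j _ => ?_)) ((hy a).1.2.2 i hia)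
    by_cases hAj : L.A j i = 0
    · simp [hAj]
    · beta_reduce
      rw [Finset.sum_eq_single a]
      · intro a' _ hne
        exact (hy a').1.2.1 j fun h => hne (hdisj a' a i ⟨j, h, hAj⟩ hia)
      · simp
  · rw [L.dualValue_sum]
    calc L.dualValue y' = L.dualValue (fun j => ∑ a, (C a).indicator y' j) := by
          refine Finset.sum_congr rfl fun j _ => ?_
          congr 1
          beta_reduce
          by_cases hj : j ∈ S
          · obtain ⟨a, ha⟩ := (hS j).1 hj
            rw [Finset.sum_eq_single a, Set.indicator_of_mem ha]
            · exact fun a' _ hne => Set.indicator_of_notMem (fun h => hne (hdisj' _ _ j h ha)) _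
            · simp
          · rw [hy'.2.1 j hj, Finset.sum_eq_zero]
            exact fun a _ => Set.indicator_of_notMem (fun h => hj (hsub a h)) _
      _ = ∑ a, L.dualValue ((C a).indicator y') := L.dualValue_sum _
      _ ≤ ∑ a, L.dualValue (y a) := Finset.sum_le_sum fun a _ => (hy a).2 _
            (L.subDualFeasible_indicator hy'.1 fun i hi =>
              hy'.2.2 i (L.subVars_mono (hsub a) hi))

theorem SubDualFeasible.dualFeasible [Fintype Vd] {S : Set Vd} {y : Vd → ℝ}
    (h : L.SubDualFeasible S y) :
    L.DualFeasible y := by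
  refine ⟨h.1, fun i => ?_⟩
  by_cases hi : i ∈ L.subVars S
  · exact h.2.2 i hi
  · rw [Finset.sum_eq_zero]
    · exact L.c_nonneg i
    · intro j _
      by_cases hj : j ∈ S
      · have : L.A j i = 0 := by
          by_contra hA
          exact hi ⟨j, hj, hA⟩
        simp [this]
      · simp [h.2.1 j hj]

/-- If `x` covers every non-trivial inequality at least `m` times, then the rescaled vector is
feasible, and cheaper than `x` by a factor `m`. -/
theorem rescale_feasible [Fintype Vp] [Fintype Vd] {x : Vp → ℝ}
    (h0 : ∀ i, 0 ≤ x i) {m : ℝ} (hm : 0 < m)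
    (hcov : ∀ j, m * L.b j ≤ ∑ i, L.A j i * x i) :
    L.PrimalFeasible (L.rescale x) ∧ m * L.primalValue (L.rescale x) ≤ L.primalValue x := by
  have hle : ∀ i, ∀ h : (L.rowsOf i).Nonempty,
      m ≤ (L.rowsOf i).inf' h (fun j => (∑ k, L.A j k * x k) / L.b j) := by
    intro i h
    refine Finset.le_inf' h _ fun j hj => ?_
    rw [rowsOf, Finset.mem_filter] at hj
    rw [le_div_iff₀ hj.2.2]
    exact hcov j
  have hnn : ∀ i, 0 ≤ L.rescale x i := by
    intro i
    unfold rescale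
    split_ifs with h
    · exact div_nonneg (h0 i) (hm.le.trans (hle i h))
    · exact le_rfl
  refine ⟨⟨hnn, fun j => ?_⟩, ?_⟩
  · rcases (L.b_nonneg j).eq_or_lt with hb | hb
    · rw [← hb]
      exact Finset.sum_nonneg fun i _ => mul_nonneg (L.A_nonneg j i) (hnn i)
    · have hpos : 0 < ∑ i, L.A j i * x i := lt_of_lt_of_le (mul_pos hm hb) (hcov j)
      calc L.b j = (∑ i, L.A j i * x i) / ((∑ i, L.A j i * x i) / L.b j) := by
            field_simp
        _ = ∑ i, L.A j i * (x i / ((∑ i, L.A j i * x i) / L.b j)) := by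
            rw [Finset.sum_div]
            exact Finset.sum_congr rfl fun i _ => mul_div_assoc _ _ _
        _ ≤ ∑ i, L.A j i * L.rescale x i := by
            refine Finset.sum_le_sum fun i _ => ?_
            by_cases hA : L.A j i = 0
            · simp [hA]
            · have hj : j ∈ L.rowsOf i := by simp [rowsOf, hA, hb]
              refine mul_le_mul_of_nonneg_left ?_ (L.A_nonneg j i)
              rw [rescale, dif_pos ⟨j, hj⟩]
              exact div_le_div_of_nonneg_left (h0 i) (hm.trans_le (hle i _))
                (Finset.inf'_le (fun j => (∑ k, L.A j k * x k) / L.b j) hj)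
  · unfold primalValue
    rw [Finset.mul_sum]
    refine Finset.sum_le_sum fun i _ => ?_
    have : m * L.rescale x i ≤ x i := by
      unfold rescale
      split_ifs with h
      · have hl := hle i h
        rw [mul_div_assoc', div_le_iff₀ (hm.trans_le hl), mul_comm]
        exact mul_le_mul_of_nonneg_left hl (h0 i)
      · simpa using h0 i
    calc m * (L.c i * L.rescale x i) = L.c i * (m * L.rescale x i) := by ring
      _ ≤ L.c i * x i := mul_le_mul_of_nonneg_left this (L.c_nonneg i)

theorem sum_ite_mem_eq_count {ℓ : ℕ} (S : Fin ℓ → Set Vd) (j : Vd) (z : ℝ) :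
    ∑ t, (if j ∈ S t then z else 0) = ((Finset.univ.filter fun t => j ∈ S t).card : ℝ) * z := by
  rw [← Finset.sum_filter, Finset.sum_const, nsmul_eq_mul]

/-- If every row lies in at least `κ * ℓ` of the sets `S t`, then the sum of the optimal solutions
of the sub-LPs yields `1 / κ`-approximations.  The primal bound compares `xs t` with the
restriction of a feasible `x'` to `P_{S t}`, the dual one compares `ys t` with the restriction of
a feasible `y'` to `S t`. -/
theorem approx_of_count [Fintype Vp] [Fintype Vd] {ℓ : ℕ} (hℓ : 0 < ℓ)
    {κ : ℝ} (hκ : 0 < κ) {S : Fin ℓ → Set Vd}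
    (hcount : ∀ j, κ * ℓ ≤ ((Finset.univ.filter fun t => j ∈ S t).card : ℝ))
    {xs : Fin ℓ → Vp → ℝ} {ys : Fin ℓ → Vd → ℝ}
    (hxs : ∀ t, L.SubPrimalOptimal (S t) (xs t)) (hys : ∀ t, L.SubDualOptimal (S t) (ys t)) :
    L.IsPrimalApprox (1 / κ) (L.rescale fun k => ∑ t, xs t k) ∧
      L.IsDualApprox (1 / κ) (fun j => (∑ t, ys t j) / ℓ) := by
  have hℓ' : (0 : ℝ) < ℓ := Nat.cast_pos.2 hℓ
  have hm : 0 < κ * ℓ := mul_pos hκ hℓ'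
  have hcov : ∀ j, κ * ℓ * L.b j ≤ ∑ i, L.A j i * ∑ t, xs t i := by
    intro j
    calc κ * ℓ * L.b j ≤ ((Finset.univ.filter fun t => j ∈ S t).card : ℝ) * L.b j :=
          mul_le_mul_of_nonneg_right (hcount j) (L.b_nonneg j)
      _ = ∑ t, (if j ∈ S t then L.b j else 0) := (sum_ite_mem_eq_count S j _).symm
      _ ≤ ∑ t, ∑ i, L.A j i * xs t i := by
          refine Finset.sum_le_sum fun t _ => ?_
          split_ifs with h
          · exact (hxs t).1.2.2 j h
          · exact Finset.sum_nonneg fun i _ => mul_nonneg (L.A_nonneg j i) ((hxs t).1.1 i)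
      _ = ∑ i, L.A j i * ∑ t, xs t i := by
          rw [Finset.sum_comm]
          exact Finset.sum_congr rfl fun i _ => (Finset.mul_sum _ _ _).symm
  obtain ⟨hfeas, hval⟩ := L.rescale_feasible (x := fun k => ∑ t, xs t k)
    (fun i => Finset.sum_nonneg fun t _ => (hxs t).1.1 i) hm hcov
  refine ⟨⟨hfeas, fun x' hx' => ?_⟩, ⟨⟨fun j => ?_, fun i => ?_⟩, fun y' hy' => ?_⟩⟩
  · rw [L.primalValue_sum] at hval
    have h1 : ∑ t, L.primalValue (xs t) ≤ ℓ * L.primalValue x' := by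
      calc ∑ t, L.primalValue (xs t) ≤ ∑ _t : Fin ℓ, L.primalValue x' := by
            refine Finset.sum_le_sum fun t _ => ?_
            refine ((hxs t).2 _ (L.subPrimalFeasible_indicator hx'.1 fun j _ => hx'.2 j)).trans ?_
            exact Finset.sum_le_sum fun i _ => mul_le_mul_of_nonneg_left
              (Set.indicator_le_self' (fun i _ => hx'.1 i) i) (L.c_nonneg i)
        _ = ℓ * L.primalValue x' := by simp
    rw [one_div, ← div_eq_inv_mul, le_div_iff₀ hκ]
    have h2 := hval.trans h1
    refine le_of_mul_le_mul_left ?_ hℓ'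
    linarith
  · exact div_nonneg (Finset.sum_nonneg fun t _ => (hys t).1.1 j) hℓ'.le
  · have h1 : ∑ j, L.A j i * ∑ t, ys t j ≤ ℓ * L.c i := by
      calc ∑ j, L.A j i * ∑ t, ys t j = ∑ t, ∑ j, L.A j i * ys t j := by
            rw [Finset.sum_comm]
            exact Finset.sum_congr rfl fun j _ => Finset.mul_sum _ _ _
        _ ≤ ∑ _t : Fin ℓ, L.c i := Finset.sum_le_sum fun t _ =>
            (SubDualFeasible.dualFeasible L (hys t).1).2 i
        _ = ℓ * L.c i := by simp
    simp_rw [mul_div_assoc']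
    rw [← Finset.sum_div, div_le_iff₀ hℓ']
    linarith
  · have h1 : κ * ℓ * L.dualValue y' ≤ ∑ t, L.dualValue (ys t) := by
      calc κ * ℓ * L.dualValue y'
          ≤ ∑ j, ∑ t, (if j ∈ S t then L.b j * y' j else 0) := by
            unfold dualValue
            rw [Finset.mul_sum]
            refine Finset.sum_le_sum fun j _ => ?_
            rw [sum_ite_mem_eq_count]
            exact mul_le_mul_of_nonneg_right (hcount j) (mul_nonneg (L.b_nonneg j) (hy'.1 j))
        _ = ∑ t, L.dualValue ((S t).indicator y') := by
            rw [Finset.sum_comm]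
            refine Finset.sum_congr rfl fun t _ => Finset.sum_congr rfl fun j _ => ?_
            by_cases h : j ∈ S t <;> simp [h]
        _ ≤ ∑ t, L.dualValue (ys t) := Finset.sum_le_sum fun t _ => (hys t).2 _
            (L.subDualFeasible_indicator hy'.1 fun i _ => hy'.2 i)
    have h2 : L.dualValue (fun j => (∑ t, ys t j) / ℓ) = (∑ t, L.dualValue (ys t)) / ℓ := by
      rw [← L.dualValue_sum]
      unfold dualValue
      rw [Finset.sum_div]
      exact Finset.sum_congr rfl fun j _ => mul_div_assoc' _ _ _
    rw [h2, one_div, ← div_eq_inv_mul, le_div_iff₀ hκ, le_div_iff₀ hℓ']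
    linarith

end CoveringLP

/-! ### Distances in graphs -/

theorem SimpleGraph.edist_le_natCast_iff {V : Type} {G : SimpleGraph V} {u w : V} {k : ℕ} :
    G.edist u w ≤ k ↔ ∃ p : G.Walk u w, p.length ≤ k := by
  constructor
  · intro h
    obtain ⟨p, hp⟩ := SimpleGraph.exists_walk_of_edist_ne_top
      (ne_top_of_le_ne_top (ENat.natCast_ne_top k) h)
    rw [← hp] at h
    exact ⟨p, by exact_mod_cast h⟩
  · rintro ⟨p, hp⟩
    exact (SimpleGraph.edist_le p).trans (by exact_mod_cast hp)

theorem SimpleGraph.edist_le_add_natCast {V : Type} {G : SimpleGraph V} {u v w : V} {m k : ℕ}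
    (h : G.edist u v ≤ m) (h' : G.edist v w ≤ k) : G.edist u w ≤ (m + k : ℕ) := by
  push_cast
  exact SimpleGraph.edist_triangle.trans (add_le_add h h')

theorem SimpleGraph.edist_le_one_of_adj {V : Type} {G : SimpleGraph V} {u v : V}
    (h : G.Adj u v) : G.edist u v ≤ (1 : ℕ) :=
  SimpleGraph.edist_le_natCast_iff.2 ⟨h.toWalk, by simp⟩

theorem SimpleGraph.edist_map_le {V V' : Type} {G : SimpleGraph V} {G' : SimpleGraph V'}
    {φ : V' → V} (hφ : ∀ u w, G'.Adj u w → G.Adj (φ u) (φ w)) {u w : V'} {k : ℕ}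
    (h : G'.edist u w ≤ k) : G.edist (φ u) (φ w) ≤ k := by
  obtain ⟨p, hp⟩ := SimpleGraph.edist_le_natCast_iff.1 h
  let F : G' →g G := ⟨φ, fun h => hφ _ _ h⟩
  exact SimpleGraph.edist_le_natCast_iff.2 ⟨p.map F, by simpa using hp⟩

/-- Balls that grow by at most `c` along an edge grow by at most `c * k` along `k` edges. -/
theorem SimpleGraph.mem_ball_of_edist_le {V : Type} {G : SimpleGraph V} {B : ℕ → V → Prop}
    {c : ℕ} (hB : ∀ m u w, B m u → G.Adj u w → B (m + c) w) (hmono : ∀ m n u, m ≤ n → B m u → B n u)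
    {m k : ℕ} {u w : V} (hu : B m u) (h : G.edist u w ≤ k) : B (m + c * k) w := by
  obtain ⟨p, hp⟩ := SimpleGraph.edist_le_natCast_iff.1 h
  clear h
  induction p generalizing m k with
  | nil => exact hmono _ _ _ (Nat.le_add_right _ _) hu
  | cons hadj p ih =>
    rw [SimpleGraph.Walk.length_cons] at hp
    obtain ⟨k, rfl⟩ : ∃ k', k = k' + 1 := ⟨k - 1, by omega⟩
    have := ih (hB _ _ _ hu hadj) (k := k) (by omega)
    exact hmono _ _ _ (le_of_eq (by ring)) this

/-- A map `φ : V' → V` that lifts all edges at vertices of a large ball lifts all short walks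
starting in a smaller ball. -/
theorem SimpleGraph.exists_lift_of_edist_le {V V' : Type} {G : SimpleGraph V}
    {G' : SimpleGraph V'} {φ : V' → V} {B : ℕ → V → Prop} {c T : ℕ}
    (hlift : ∀ m u' w, B m (φ u') → m + c ≤ T → G.Adj (φ u') w → ∃ w', φ w' = w ∧ G'.Adj u' w')
    (hB : ∀ m u w, B m u → G.Adj u w → B (m + c) w)
    {m k : ℕ} {u' : V'} {w : V} (hu : B m (φ u')) (hT : m + c * k ≤ T)
    (h : G.edist (φ u') w ≤ k) : ∃ w', φ w' = w ∧ G'.edist u' w' ≤ k := by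
  obtain ⟨p, hp⟩ := SimpleGraph.edist_le_natCast_iff.1 h
  clear h
  generalize hu' : φ u' = u at p hu
  induction p generalizing m k u' with
  | nil => exact ⟨u', hu', by simp⟩
  | @cons u v w hadj p ih =>
    rw [SimpleGraph.Walk.length_cons] at hp
    obtain ⟨k, rfl⟩ : ∃ k', k = k' + 1 := ⟨k - 1, by omega⟩
    rw [mul_add, mul_one] at hT
    obtain ⟨v', hv', hadj'⟩ := hlift m u' v (hu' ▸ hu) (by omega) (hu' ▸ hadj)
    obtain ⟨w', hw', hle⟩ := ih (m := m + c) (k := k) (u' := v') (by omega) hv'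
      (hB _ _ _ hu hadj) (by omega)
    refine ⟨w', hw', ?_⟩
    rw [add_comm k 1]
    exact SimpleGraph.edist_le_add_natCast (SimpleGraph.edist_le_one_of_adj hadj') hle

theorem ENat.lt_natCast_iff {x : ℕ∞} {n : ℕ} : x < n ↔ ∃ m : ℕ, m < n ∧ x ≤ m := by
  constructor
  · intro h
    lift x to ℕ using (ne_top_of_lt h)
    exact ⟨x, by exact_mod_cast h, le_rfl⟩
  · rintro ⟨m, hm, hx⟩
    exact hx.trans_lt (by exact_mod_cast hm)

/-! ### A canonical result of the algorithm -/

/-- A fixed element of a set of functions, or `0` if the set is empty. -/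
noncomputable def pick {ID : Type} (Z : Set (ID → ℝ)) : ID → ℝ :=
  if h : Z.Nonempty then h.some else 0

theorem pick_mem {ID : Type} {Z : Set (ID → ℝ)} (h : Z.Nonempty) : pick Z ∈ Z := by
  rw [pick, dif_pos h]
  exact h.some_mem

theorem pick_apply_eq_zero {ID : Type} {Z : Set (ID → ℝ)} {a : ID} (h : ∀ z ∈ Z, z a = 0) :
    pick Z a = 0 := by
  by_cases hZ : Z.Nonempty
  · exact h _ (pick_mem hZ)
  · rw [pick, dif_neg hZ]
    rfl

namespace CoveringLP

variable {Vp Vd ID : Type}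

section Choice

/-- The optimal solutions of `P_S`, written as functions of identifiers.  Two networks that agree
near `S` give the same set, so that a choice from it is a choice by local rules. -/
def primalOptima [Fintype Vp] (L : CoveringLP Vp Vd) (ident : Vp ⊕ Vd → ID) (S : Set Vd) :
    Set (ID → ℝ) :=
  {z | ∃ x, L.SubPrimalOptimal S x ∧ z = Function.extend (fun i => ident (Sum.inl i)) x 0}

/-- The optimal solutions of `D_S`, written as functions of identifiers. -/
def dualOptima [Fintype Vd] (L : CoveringLP Vp Vd) (ident : Vp ⊕ Vd → ID) (S : Set Vd) :
    Set (ID → ℝ) :=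
  {z | ∃ y, L.SubDualOptimal S y ∧ z = Function.extend (fun j => ident (Sum.inr j)) y 0}

/-- A fixed optimal solution of `P_S` (or `0`, if there is none). -/
noncomputable def chosenPrimal [Fintype Vp] (L : CoveringLP Vp Vd) (ident : Vp ⊕ Vd → ID)
    (S : Set Vd) (i : Vp) : ℝ :=
  pick (L.primalOptima ident S) (ident (Sum.inl i))

/-- A fixed optimal solution of `D_S` (or `0`, if there is none). -/
noncomputable def chosenDual [Fintype Vd] (L : CoveringLP Vp Vd) (ident : Vp ⊕ Vd → ID)
    (S : Set Vd) (j : Vd) : ℝ :=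
  pick (L.dualOptima ident S) (ident (Sum.inr j))

variable (L : CoveringLP Vp Vd) {ident : Vp ⊕ Vd → ID}

theorem chosenPrimal_optimal [Fintype Vp] [Fintype Vd] (hident : Function.Injective ident)
    {S : Set Vd} (h : ∃ x, L.SubPrimalFeasible S x) :
    L.SubPrimalOptimal S (L.chosenPrimal ident S) := by
  obtain ⟨x₀, hx₀⟩ := L.exists_subPrimalOptimal h
  obtain ⟨x, hx, hz⟩ := pick_mem (Z := L.primalOptima ident S) ⟨_, x₀, hx₀, rfl⟩
  have : L.chosenPrimal ident S = x := by
    funext i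
    rw [chosenPrimal, hz]
    exact (hident.comp Sum.inl_injective).extend_apply x 0 i
  rwa [this]

theorem chosenDual_optimal [Fintype Vp] [Fintype Vd] (hident : Function.Injective ident)
    {S : Set Vd} (h : ∃ x, L.SubPrimalFeasible S x) :
    L.SubDualOptimal S (L.chosenDual ident S) := by
  obtain ⟨y₀, hy₀⟩ := L.exists_subDualOptimal h
  obtain ⟨y, hy, hz⟩ := pick_mem (Z := L.dualOptima ident S) ⟨_, y₀, hy₀, rfl⟩
  have : L.chosenDual ident S = y := by
    funext j
    rw [chosenDual, hz]
    exact (hident.comp Sum.inr_injective).extend_apply y 0 j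
  rwa [this]

theorem chosenPrimal_eq_zero [Fintype Vp] (hident : Function.Injective ident)
    {S : Set Vd} {i : Vp} (hi : i ∉ L.subVars S) :
    L.chosenPrimal ident S i = 0 := by
  refine pick_apply_eq_zero ?_
  rintro z ⟨x, hx, rfl⟩
  exact ((hident.comp Sum.inl_injective).extend_apply x 0 i).trans (hx.1.2.1 i hi)

theorem chosenDual_eq_zero [Fintype Vd] (hident : Function.Injective ident)
    {S : Set Vd} {j : Vd} (hj : j ∉ S) :
    L.chosenDual ident S j = 0 := by
  refine pick_apply_eq_zero ?_
  rintro z ⟨y, hy, rfl⟩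
  exact ((hident.comp Sum.inr_injective).extend_apply y 0 j).trans (hy.1.2.1 j hj)

end Choice

variable [LinearOrder ID]

/-- The nodes of the Linial–Saks set whose leader is `v`. -/
def cluster (L : CoveringLP Vp Vd) (ident : Vp ⊕ Vd → ID) (r : Vd → ℕ) (v : Vd) : Set Vd :=
  {j | IsLeader L.clusterGraph (fun j => ident (Sum.inr j)) r v j ∧ L.clusterGraph.edist j v < r v}

theorem clusterGraph_edist_le_one (L : CoveringLP Vp Vd) {j j' : Vd} {i : Vp}
    (hj : L.A j i ≠ 0) (hj' : L.A j' i ≠ 0) : L.clusterGraph.edist j j' ≤ (1 : ℕ) := by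
  by_cases h : j = j'
  · simp [h]
  · refine SimpleGraph.edist_le_one_of_adj ⟨h, ?_⟩
    have h1 : L.network.Adj (Sum.inr j) (Sum.inl i) := Or.inr ⟨i, j, hj, rfl, rfl⟩
    have h2 : L.network.Adj (Sum.inl i) (Sum.inr j') := Or.inl ⟨i, j', hj', rfl, rfl⟩
    refine (SimpleGraph.edist_le_add_natCast (SimpleGraph.edist_le_one_of_adj h1)
      (SimpleGraph.edist_le_one_of_adj h2)).trans ?_
    norm_num

/-- Nodes of a cluster have distance less than the radius from their leader, so their neighbours
still hear this leader.  Hence distinct clusters are not adjacent. -/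
theorem cluster_leader_unique (L : CoveringLP Vp Vd) {ident : Vp ⊕ Vd → ID}
    (hident : Function.Injective ident) {r : Vd → ℕ} {v v' j j' : Vd}
    (h : L.clusterGraph.edist j j' ≤ (1 : ℕ))
    (hj : j ∈ L.cluster ident r v) (hj' : j' ∈ L.cluster ident r v') : v = v' := by
  have key : ∀ {u u' k k' : Vd}, L.clusterGraph.edist k' k ≤ (1 : ℕ) →
      k ∈ L.cluster ident r u → k' ∈ L.cluster ident r u' →
      ident (Sum.inr u) ≤ ident (Sum.inr u') := by
    intro u u' k k' hkk hk hk'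
    refine hk'.1.2 u ?_
    obtain ⟨m, hm, hle⟩ := ENat.lt_natCast_iff.1 hk.2
    refine (SimpleGraph.edist_le_add_natCast hkk hle).trans ?_
    exact_mod_cast (by omega : 1 + m ≤ r u)
  have := le_antisymm (key (by rwa [SimpleGraph.edist_comm]) hj hj') (key h hj' hj)
  exact Sum.inr_injective (hident this)

variable {R ℓ : ℕ}

section Output

variable [Fintype Vp] [Fintype Vd]

/-- The optimal solution of `P_{𝒮 t}` that is composed of the fixed solutions on the clusters. -/
noncomputable def clusteredPrimal (L : CoveringLP Vp Vd) (ident : Vp ⊕ Vd → ID)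
    (r : Fin ℓ → Vd → Fin (R + 1)) (t : Fin ℓ) (i : Vp) : ℝ :=
  ∑ v, L.chosenPrimal ident (L.cluster ident (fun j => (r t j : ℕ)) v) i

/-- The optimal solution of `D_{𝒮 t}` that is composed of the fixed solutions on the clusters. -/
noncomputable def clusteredDual (L : CoveringLP Vp Vd) (ident : Vp ⊕ Vd → ID)
    (r : Fin ℓ → Vd → Fin (R + 1)) (t : Fin ℓ) (j : Vd) : ℝ :=
  ∑ v, L.chosenDual ident (L.cluster ident (fun j => (r t j : ℕ)) v) j

/-- The result of the algorithm if the sub-LPs are solved cluster by cluster. -/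
noncomputable def canonicalOutput (L : CoveringLP Vp Vd) (ident : Vp ⊕ Vd → ID)
    (r : Fin ℓ → Vd → Fin (R + 1)) : Vp ⊕ Vd → ℝ
  | Sum.inl i => L.rescale (fun k => ∑ t, L.clusteredPrimal ident r t k) i
  | Sum.inr j => (∑ t, L.clusteredDual ident r t j) / ℓ

theorem canonicalOutput_isAlgorithmResult (L : CoveringLP Vp Vd) {ident : Vp ⊕ Vd → ID}
    (hident : Function.Injective ident) (h : ∃ x, L.PrimalFeasible x)
    (r : Fin ℓ → Vd → Fin (R + 1)) :
    L.IsAlgorithmResult ident r (fun i => L.canonicalOutput ident r (Sum.inl i))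
      (fun j => L.canonicalOutput ident r (Sum.inr j)) := by
  obtain ⟨x₀, hx₀⟩ := h
  have hfeas : ∀ S, ∃ x, L.SubPrimalFeasible S x := fun S =>
    ⟨_, L.subPrimalFeasible_indicator (S := S) hx₀.1 fun j _ => hx₀.2 j⟩
  have hmem : ∀ t j, j ∈ L.lsSet ident r t ↔
      ∃ v, j ∈ L.cluster ident (fun j => (r t j : ℕ)) v := fun t j => Iff.rfl
  have hdisj : ∀ (t : Fin ℓ) (v v' : Vd) (i : Vp),
      i ∈ L.subVars (L.cluster ident (fun j => (r t j : ℕ)) v) →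
      i ∈ L.subVars (L.cluster ident (fun j => (r t j : ℕ)) v') → v = v' := by
    rintro t v v' i ⟨j, hj, hA⟩ ⟨j', hj', hA'⟩
    exact L.cluster_leader_unique hident (L.clusterGraph_edist_le_one hA hA') hj hj'
  refine ⟨L.clusteredPrimal ident r, L.clusteredDual ident r, fun t => ?_, fun t => ?_,
    fun i => rfl, fun j => rfl⟩
  · exact L.subPrimalOptimal_sum (hmem t) (hdisj t)
      fun v => L.chosenPrimal_optimal hident (hfeas _)
  · exact L.subDualOptimal_sum (hmem t) (hdisj t)
      (fun v v' j hj hj' => L.cluster_leader_unique hident (by simp) hj hj')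
      fun v => L.chosenDual_optimal hident (hfeas _)

end Output

end CoveringLP

/-! ### Locality of the canonical result -/

theorem Function.extend_extend_zero {α β γ : Type} {f : α → β} {g : β → γ}
    (hg : Function.Injective g) (hf : Function.Injective f) (x : α → ℝ) :
    Function.extend g (Function.extend f x 0) 0 = Function.extend (fun a => g (f a)) x 0 := by
  funext c
  by_cases hc : ∃ b, g b = c
  · obtain ⟨b, rfl⟩ := hc
    rw [hg.extend_apply]
    by_cases hb : ∃ a, f a = b
    · obtain ⟨a, rfl⟩ := hb
      rw [hf.extend_apply]
      exact ((hg.comp hf).extend_apply x 0 a).symm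
    · rw [Function.extend_apply' _ _ _ hb, Function.extend_apply']
      · rfl
      · rintro ⟨a, ha⟩
        exact hb ⟨a, hg ha⟩
  · rw [Function.extend_apply' _ _ _ hc, Function.extend_apply']
    rintro ⟨a, ha⟩
    exact hc ⟨_, ha⟩

theorem Function.extend_comp_eq_self {α β : Type} {f : α → β} (hf : Function.Injective f)
    {x : β → ℝ} (hx : ∀ b, b ∉ Set.range f → x b = 0) :
    Function.extend f (fun a => x (f a)) 0 = x := by
  funext b
  by_cases hb : ∃ a, f a = b
  · obtain ⟨a, rfl⟩ := hb
    exact hf.extend_apply _ _ _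
  · rw [Function.extend_apply' _ _ _ hb]
    exact (hx b hb).symm

theorem sum_mul_extend {α β : Type} [Fintype α] [Fintype β] {f : α → β}
    (hf : Function.Injective f) (a : β → ℝ) (x : α → ℝ) :
    ∑ i, a i * Function.extend f x 0 i = ∑ i, a (f i) * x i := by
  symm
  refine Fintype.sum_of_injective f hf _ _ (fun i hi => ?_) (fun i => ?_)
  · rw [Function.extend_apply' _ _ _ hi]
    simp
  · rw [hf.extend_apply]

namespace CoveringLP

variable {Vp Vd Vp' Vd' ID : Type} {R ℓ : ℕ}

/-- `L'` is (via `f` and `g`) a part of the linear program `L`, with the same coefficients,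
identifiers and radii, that contains all nodes within distance `T` of the node `v₀`. -/
structure IsLocalPart (L' : CoveringLP Vp' Vd') (L : CoveringLP Vp Vd) (ident' : Vp' ⊕ Vd' → ID)
    (ident : Vp ⊕ Vd → ID) (r' : Fin ℓ → Vd' → Fin (R + 1)) (r : Fin ℓ → Vd → Fin (R + 1))
    (f : Vp' → Vp) (g : Vd' → Vd) (v₀ : Vp ⊕ Vd) (T : ℕ) : Prop where
  f_injective : Function.Injective f
  g_injective : Function.Injective g
  A_eq : ∀ j i, L'.A j i = L.A (g j) (f i)
  b_eq : ∀ j, L'.b j = L.b (g j)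
  c_eq : ∀ i, L'.c i = L.c (f i)
  ident_eq : ∀ u, ident' u = ident (Sum.map f g u)
  radii_eq : ∀ t j, r' t j = r t (g j)
  ball : ∀ u, L.network.edist v₀ u ≤ T → u ∈ Set.range (Sum.map f g)

namespace IsLocalPart

variable {L' : CoveringLP Vp' Vd'} {L : CoveringLP Vp Vd} {ident' : Vp' ⊕ Vd' → ID}
  {ident : Vp ⊕ Vd → ID} {r' : Fin ℓ → Vd' → Fin (R + 1)} {r : Fin ℓ → Vd → Fin (R + 1)}
  {f : Vp' → Vp} {g : Vd' → Vd} {v₀ : Vp ⊕ Vd} {T : ℕ}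

section SubLP

variable {S : Set Vd} {S' : Set Vd'}

theorem mem_subVars_iff (e : IsLocalPart L' L ident' ident r' r f g v₀ T)
    (hS : ∀ j, j ∈ S ↔ ∃ j' ∈ S', g j' = j) (i : Vp') :
    f i ∈ L.subVars S ↔ i ∈ L'.subVars S' := by
  constructor
  · rintro ⟨j, hj, hA⟩
    obtain ⟨j', hj', rfl⟩ := (hS j).1 hj
    exact ⟨j', hj', by rwa [e.A_eq]⟩
  · rintro ⟨j, hj, hA⟩
    exact ⟨g j, (hS _).2 ⟨j, hj, rfl⟩, by rwa [← e.A_eq]⟩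

theorem subPrimalFeasible_extend_iff [Fintype Vp] [Fintype Vp']
    (e : IsLocalPart L' L ident' ident r' r f g v₀ T)
    (hS : ∀ j, j ∈ S ↔ ∃ j' ∈ S', g j' = j) (x : Vp' → ℝ) :
    L.SubPrimalFeasible S (Function.extend f x 0) ↔ L'.SubPrimalFeasible S' x := by
  have hrow : ∀ j', ∑ i, L.A (g j') i * Function.extend f x 0 i = ∑ i, L'.A j' i * x i := by
    intro j'
    rw [sum_mul_extend e.f_injective]
    exact Finset.sum_congr rfl fun i _ => by rw [e.A_eq]
  constructor
  · rintro ⟨h0, h1, h2⟩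
    refine ⟨fun i => ?_, fun i hi => ?_, fun j hj => ?_⟩
    · simpa [e.f_injective.extend_apply] using h0 (f i)
    · have := h1 (f i) (fun h => hi ((e.mem_subVars_iff hS i).1 h))
      rwa [e.f_injective.extend_apply] at this
    · rw [← hrow, e.b_eq]
      exact h2 (g j) ((hS _).2 ⟨j, hj, rfl⟩)
  · rintro ⟨h0, h1, h2⟩
    refine ⟨fun i => ?_, fun i hi => ?_, fun j hj => ?_⟩
    · by_cases hr : ∃ i', f i' = i
      · obtain ⟨i', rfl⟩ := hr
        rw [e.f_injective.extend_apply]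
        exact h0 i'
      · rw [Function.extend_apply' _ _ _ hr]
        rfl
    · by_cases hr : ∃ i', f i' = i
      · obtain ⟨i', rfl⟩ := hr
        rw [e.f_injective.extend_apply]
        exact h1 i' (fun h => hi ((e.mem_subVars_iff hS i').2 h))
      · rw [Function.extend_apply' _ _ _ hr]
        rfl
    · obtain ⟨j', hj', rfl⟩ := (hS j).1 hj
      rw [hrow, ← e.b_eq]
      exact h2 j' hj'

theorem subDualFeasible_extend_iff [Fintype Vd] [Fintype Vd']
    (e : IsLocalPart L' L ident' ident r' r f g v₀ T)
    (hS : ∀ j, j ∈ S ↔ ∃ j' ∈ S', g j' = j) (hvars : ∀ i ∈ L.subVars S, i ∈ Set.range f)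
    (y : Vd' → ℝ) :
    L.SubDualFeasible S (Function.extend g y 0) ↔ L'.SubDualFeasible S' y := by
  have hcol : ∀ i', ∑ j, L.A j (f i') * Function.extend g y 0 j = ∑ j, L'.A j i' * y j := by
    intro i'
    rw [sum_mul_extend e.g_injective (fun j => L.A j (f i'))]
    exact Finset.sum_congr rfl fun i _ => by rw [e.A_eq]
  have hmem : ∀ j', g j' ∈ S ↔ j' ∈ S' := by
    intro j'
    rw [hS]
    constructor
    · rintro ⟨j, hj, h⟩
      rwa [← e.g_injective h]
    · exact fun h => ⟨j', h, rfl⟩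
  constructor
  · rintro ⟨h0, h1, h2⟩
    refine ⟨fun j => ?_, fun j hj => ?_, fun i hi => ?_⟩
    · simpa [e.g_injective.extend_apply] using h0 (g j)
    · have := h1 (g j) (fun h => hj ((hmem j).1 h))
      rwa [e.g_injective.extend_apply] at this
    · rw [← hcol, e.c_eq]
      exact h2 (f i) ((e.mem_subVars_iff hS i).2 hi)
  · rintro ⟨h0, h1, h2⟩
    refine ⟨fun j => ?_, fun j hj => ?_, fun i hi => ?_⟩
    · by_cases hr : ∃ j', g j' = j
      · obtain ⟨j', rfl⟩ := hr
        rw [e.g_injective.extend_apply]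
        exact h0 j'
      · rw [Function.extend_apply' _ _ _ hr]
        rfl
    · by_cases hr : ∃ j', g j' = j
      · obtain ⟨j', rfl⟩ := hr
        rw [e.g_injective.extend_apply]
        exact h1 j' (fun h => hj ((hmem j').2 h))
      · rw [Function.extend_apply' _ _ _ hr]
        rfl
    · obtain ⟨i', rfl⟩ := hvars i hi
      rw [hcol, ← e.c_eq]
      exact h2 i' ((e.mem_subVars_iff hS i').1 hi)

theorem primalValue_extend [Fintype Vp] [Fintype Vp']
    (e : IsLocalPart L' L ident' ident r' r f g v₀ T) (x : Vp' → ℝ) :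
    L.primalValue (Function.extend f x 0) = L'.primalValue x := by
  unfold primalValue
  rw [sum_mul_extend e.f_injective]
  exact Finset.sum_congr rfl fun i _ => by rw [e.c_eq]

theorem dualValue_extend [Fintype Vd] [Fintype Vd']
    (e : IsLocalPart L' L ident' ident r' r f g v₀ T) (y : Vd' → ℝ) :
    L.dualValue (Function.extend g y 0) = L'.dualValue y := by
  unfold dualValue
  rw [sum_mul_extend e.g_injective]
  exact Finset.sum_congr rfl fun i _ => by rw [e.b_eq]

theorem primalOptima_eq [Fintype Vp] [Fintype Vp']
    (e : IsLocalPart L' L ident' ident r' r f g v₀ T) (hident : Function.Injective ident)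
    (hS : ∀ j, j ∈ S ↔ ∃ j' ∈ S', g j' = j) (hvars : ∀ i ∈ L.subVars S, i ∈ Set.range f) :
    L'.primalOptima ident' S' = L.primalOptima ident S := by
  have hid : ∀ x : Vp' → ℝ, Function.extend (fun i => ident (Sum.inl i)) (Function.extend f x 0) 0 =
      Function.extend (fun i => ident' (Sum.inl i)) x 0 := by
    intro x
    refine (Function.extend_extend_zero (hident.comp Sum.inl_injective) e.f_injective x).trans ?_
    congr 1
    funext i
    exact (e.ident_eq (Sum.inl i)).symm
  have hres : ∀ x, L.SubPrimalFeasible S x → ∃ x' : Vp' → ℝ, Function.extend f x' 0 = x :=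
    fun x hx => ⟨_, Function.extend_comp_eq_self e.f_injective
      fun i hi => hx.2.1 i fun h => hi (hvars i h)⟩
  ext z
  constructor
  · rintro ⟨x, hx, rfl⟩
    refine ⟨Function.extend f x 0, ⟨(e.subPrimalFeasible_extend_iff hS x).2 hx.1,
      fun x' hx' => ?_⟩, (hid x).symm⟩
    obtain ⟨x', rfl⟩ := hres x' hx'
    rw [e.primalValue_extend, e.primalValue_extend]
    exact hx.2 _ ((e.subPrimalFeasible_extend_iff hS _).1 hx')
  · rintro ⟨x, hx, rfl⟩
    obtain ⟨x, rfl⟩ := hres x hx.1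
    refine ⟨_, ⟨(e.subPrimalFeasible_extend_iff hS _).1 hx.1, fun x' hx' => ?_⟩, hid _⟩
    rw [← e.primalValue_extend, ← e.primalValue_extend]
    exact hx.2 _ ((e.subPrimalFeasible_extend_iff hS _).2 hx')

theorem dualOptima_eq [Fintype Vd] [Fintype Vd']
    (e : IsLocalPart L' L ident' ident r' r f g v₀ T) (hident : Function.Injective ident)
    (hS : ∀ j, j ∈ S ↔ ∃ j' ∈ S', g j' = j) (hvars : ∀ i ∈ L.subVars S, i ∈ Set.range f) :
    L'.dualOptima ident' S' = L.dualOptima ident S := by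
  have hid : ∀ y : Vd' → ℝ, Function.extend (fun j => ident (Sum.inr j)) (Function.extend g y 0) 0 =
      Function.extend (fun j => ident' (Sum.inr j)) y 0 := by
    intro y
    refine (Function.extend_extend_zero (hident.comp Sum.inr_injective) e.g_injective y).trans ?_
    congr 1
    funext j
    exact (e.ident_eq (Sum.inr j)).symm
  have hres : ∀ y, L.SubDualFeasible S y → ∃ y' : Vd' → ℝ, Function.extend g y' 0 = y := by
    refine fun y hy => ⟨_, Function.extend_comp_eq_self e.g_injective
      fun j hj => hy.2.1 j fun h => hj ?_⟩
    obtain ⟨j', -, h'⟩ := (hS j).1 h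
    exact ⟨j', h'⟩
  ext z
  constructor
  · rintro ⟨y, hy, rfl⟩
    refine ⟨Function.extend g y 0, ⟨(e.subDualFeasible_extend_iff hS hvars y).2 hy.1,
      fun y' hy' => ?_⟩, (hid y).symm⟩
    obtain ⟨y', rfl⟩ := hres y' hy'
    rw [e.dualValue_extend, e.dualValue_extend]
    exact hy.2 _ ((e.subDualFeasible_extend_iff hS hvars _).1 hy')
  · rintro ⟨y, hy, rfl⟩
    obtain ⟨y, rfl⟩ := hres y hy.1
    refine ⟨_, ⟨(e.subDualFeasible_extend_iff hS hvars _).1 hy.1, fun y' hy' => ?_⟩, hid _⟩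
    rw [← e.dualValue_extend, ← e.dualValue_extend]
    exact hy.2 _ ((e.subDualFeasible_extend_iff hS hvars _).2 hy')

end SubLP

/-! ### Distances and clusters in a part of the network -/

theorem network_adj_iff (e : IsLocalPart L' L ident' ident r' r f g v₀ T) (u w : Vp' ⊕ Vd') :
    L.network.Adj (Sum.map f g u) (Sum.map f g w) ↔ L'.network.Adj u w := by
  have hf : ∀ a b, f a = f b ↔ a = b := fun a b => e.f_injective.eq_iff
  have hg : ∀ a b, g a = g b ↔ a = b := fun a b => e.g_injective.eq_iff
  rcases u with i | j <;> rcases w with i' | j' <;> simp [network, e.A_eq]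

theorem network_edist_map_le (e : IsLocalPart L' L ident' ident r' r f g v₀ T)
    {u w : Vp' ⊕ Vd'} {k : ℕ} (h : L'.network.edist u w ≤ k) :
    L.network.edist (Sum.map f g u) (Sum.map f g w) ≤ k :=
  SimpleGraph.edist_map_le (fun u w h => (e.network_adj_iff u w).2 h) h

theorem exists_lift_of_network_edist_le (e : IsLocalPart L' L ident' ident r' r f g v₀ T)
    {m k : ℕ} {u : Vp' ⊕ Vd'} {w : Vp ⊕ Vd} (hu : L.network.edist v₀ (Sum.map f g u) ≤ m)
    (hT : m + k ≤ T) (h : L.network.edist (Sum.map f g u) w ≤ k) :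
    ∃ w', Sum.map f g w' = w ∧ L'.network.edist u w' ≤ k := by
  refine SimpleGraph.exists_lift_of_edist_le (B := fun m u => L.network.edist v₀ u ≤ (m : ℕ))
    (c := 1) (T := T) ?_ ?_ hu (by omega) h
  · intro m u w hu hm hadj
    have hw := SimpleGraph.edist_le_add_natCast hu (SimpleGraph.edist_le_one_of_adj hadj)
    obtain ⟨w', rfl⟩ := e.ball w (hw.trans (by exact_mod_cast hm))
    exact ⟨w', rfl, (e.network_adj_iff _ _).1 hadj⟩
  · exact fun m u w hu hadj =>
      SimpleGraph.edist_le_add_natCast hu (SimpleGraph.edist_le_one_of_adj hadj)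

theorem clusterGraph_edist_map_le (e : IsLocalPart L' L ident' ident r' r f g v₀ T)
    {j j' : Vd'} {k : ℕ} (h : L'.clusterGraph.edist j j' ≤ k) :
    L.clusterGraph.edist (g j) (g j') ≤ k := by
  refine SimpleGraph.edist_map_le (G := L.clusterGraph)
    (G' := L'.clusterGraph) (φ := g)
    (fun u w h => ⟨fun h' => h.1 (e.g_injective h'), ?_⟩) h
  exact e.network_edist_map_le (u := Sum.inr u) (w := Sum.inr w) (k := 4) h.2

theorem _root_.CoveringLP.edist_of_clusterGraph_edist (L : CoveringLP Vp Vd) {v₀ : Vp ⊕ Vd}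
    {m k : ℕ} {j j' : Vd} (hj : L.network.edist v₀ (Sum.inr j) ≤ m)
    (h : L.clusterGraph.edist j j' ≤ k) :
    L.network.edist v₀ (Sum.inr j') ≤ (m + 4 * k : ℕ) := by
  refine SimpleGraph.mem_ball_of_edist_le
    (B := fun m j => L.network.edist v₀ (Sum.inr j) ≤ (m : ℕ)) ?_ ?_ hj h
  · exact fun m u w hu hadj => SimpleGraph.edist_le_add_natCast hu hadj.2
  · exact fun m n u hmn hu => hu.trans (by exact_mod_cast hmn)

theorem exists_lift_of_clusterGraph_edist_le (e : IsLocalPart L' L ident' ident r' r f g v₀ T)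
    {m k : ℕ} {j : Vd'} {w : Vd} (hj : L.network.edist v₀ (Sum.inr (g j)) ≤ m)
    (hT : m + 4 * k ≤ T) (h : L.clusterGraph.edist (g j) w ≤ k) :
    ∃ w', g w' = w ∧ L'.clusterGraph.edist j w' ≤ k := by
  refine SimpleGraph.exists_lift_of_edist_le
    (B := fun m j => L.network.edist v₀ (Sum.inr j) ≤ (m : ℕ)) ?_ ?_ hj hT h
  · rintro m u w hu hm ⟨hne, hadj⟩
    obtain ⟨w', hw', hle⟩ :=
      e.exists_lift_of_network_edist_le (u := Sum.inr u) (k := 4) hu hm hadj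
    rcases w' with i | w'
    · simp at hw'
    · obtain rfl : g w' = w := by simpa using hw'
      exact ⟨w', rfl, fun h => hne (by rw [h]), hle⟩
  · exact fun m u w hu hadj => SimpleGraph.edist_le_add_natCast hu hadj.2

theorem clusterGraph_edist_iff (e : IsLocalPart L' L ident' ident r' r f g v₀ T)
    {m k : ℕ} {j j' : Vd'} (hj : L.network.edist v₀ (Sum.inr (g j)) ≤ m) (hT : m + 4 * k ≤ T) :
    L.clusterGraph.edist (g j) (g j') ≤ k ↔ L'.clusterGraph.edist j j' ≤ k := by
  refine ⟨fun h => ?_, e.clusterGraph_edist_map_le⟩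
  obtain ⟨w, hw, hle⟩ := e.exists_lift_of_clusterGraph_edist_le hj hT h
  rwa [← e.g_injective hw]

/-- A dual node within distance `3` of `v₀` only belongs to clusters of leaders within distance
`4 * R + 3`. -/
theorem _root_.CoveringLP.edist_leader_le (L : CoveringLP Vp Vd)
    {r : Fin ℓ → Vd → Fin (R + 1)} {v₀ : Vp ⊕ Vd} {t : Fin ℓ} {j v : Vd}
    (hj : L.network.edist v₀ (Sum.inr j) ≤ (3 : ℕ))
    (h : L.clusterGraph.edist j v ≤ (r t v : ℕ)) :
    L.network.edist v₀ (Sum.inr v) ≤ (4 * R + 3 : ℕ) := by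
  refine (L.edist_of_clusterGraph_edist hj
    (h.trans (by exact_mod_cast Nat.lt_succ_iff.1 (r t v).2 : _ ≤ (R : ℕ∞)))).trans ?_
  norm_cast
  omega

theorem rescale_eq [Fintype Vp] [Fintype Vd] [Fintype Vp'] [Fintype Vd'] {i : Vp'} 
    (e : IsLocalPart L' L ident' ident r' r f g (Sum.inl (f i)) T)
    (hT : 2 ≤ T) {x' : Vp' → ℝ} {x : Vp → ℝ}
    (hx : ∀ k, L.network.edist (Sum.inl (f i)) (Sum.inl (f k)) ≤ (2 : ℕ) → x' k = x (f k)) :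
    L'.rescale x' i = L.rescale x (f i) := by
  have hadj : ∀ j, L.A j (f i) ≠ 0 →
      L.network.edist (Sum.inl (f i)) (Sum.inr j) ≤ (1 : ℕ) := fun j hA =>
    SimpleGraph.edist_le_one_of_adj (Or.inl ⟨f i, j, hA, rfl, rfl⟩)
  have hadj' : ∀ j k, L.A j (f i) ≠ 0 → L.A j k ≠ 0 →
      L.network.edist (Sum.inl (f i)) (Sum.inl k) ≤ (2 : ℕ) := fun j k hA hA' =>
    SimpleGraph.edist_le_add_natCast (hadj j hA)
      (SimpleGraph.edist_le_one_of_adj (Or.inr ⟨k, j, hA', rfl, rfl⟩))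
  have hrows : L.rowsOf (f i) = (L'.rowsOf i).image g := by
    ext j
    simp only [rowsOf, Finset.mem_filter, Finset.mem_univ, true_and, Finset.mem_image]
    constructor
    · rintro ⟨hA, hb⟩
      obtain ⟨u, hu⟩ := e.ball (Sum.inr j) ((hadj j hA).trans (by norm_cast; omega))
      rcases u with i' | j'
      · simp at hu
      · obtain rfl : g j' = j := by simpa using hu
        exact ⟨j', ⟨by rwa [e.A_eq], by rwa [e.b_eq]⟩, rfl⟩
    · rintro ⟨j', ⟨hA, hb⟩, rfl⟩
      exact ⟨by rwa [← e.A_eq], by rwa [← e.b_eq]⟩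
  have hsum : ∀ j ∈ L'.rowsOf i, (∑ k, L'.A j k * x' k) / L'.b j =
      (∑ k, L.A (g j) k * x k) / L.b (g j) := by
    intro j hj
    have hA : L.A (g j) (f i) ≠ 0 := by
      rw [← e.A_eq]
      exact (Finset.mem_filter.1 hj).2.1
    rw [e.b_eq]
    congr 1
    refine Fintype.sum_of_injective f e.f_injective _ _ (fun k hk => ?_) (fun k => ?_)
    · have : L.A (g j) k = 0 := by
        by_contra h
        obtain ⟨u, hu⟩ := e.ball (Sum.inl k) ((hadj' _ k hA h).trans (by norm_cast))
        rcases u with k' | j'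
        · exact hk ⟨k', by simpa using hu⟩
        · simp at hu
      simp [this]
    · rw [e.A_eq]
      by_cases h : L.A (g j) (f k) = 0
      · simp [h]
      · rw [hx k (hadj' _ _ hA h)]
  unfold rescale
  by_cases hne : (L'.rowsOf i).Nonempty
  · have hne' : (L.rowsOf (f i)).Nonempty := by
      rw [hrows]
      exact hne.image g
    rw [dif_pos hne, dif_pos hne', hx i (by simp)]
    congr 1
    rw [Finset.inf'_congr hne rfl hsum, Finset.inf'_congr hne' hrows fun _ _ => rfl,
      Finset.inf'_image]
    rfl
  · have hne' : ¬ (L.rowsOf (f i)).Nonempty := by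
      rw [hrows]
      simpa using hne
    rw [dif_neg hne, dif_neg hne']

variable [LinearOrder ID]

theorem mem_cluster_iff (e : IsLocalPart L' L ident' ident r' r f g v₀ T) (t : Fin ℓ)
    {m : ℕ} {j v : Vd'} (hj : L.network.edist v₀ (Sum.inr (g j)) ≤ m) (hT : m + 4 * R ≤ T) :
    g j ∈ L.cluster ident (fun j => (r t j : ℕ)) (g v) ↔
      j ∈ L'.cluster ident' (fun j => (r' t j : ℕ)) v := by
  have hr : ∀ w, (r t w : ℕ) ≤ R := fun w => Nat.lt_succ_iff.1 (r t w).2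
  have hid : ∀ w, ident' (Sum.inr w) = ident (Sum.inr (g w)) := fun w => e.ident_eq (Sum.inr w)
  have hk : ∀ (k : ℕ) (w : Vd'), k ≤ R →
      (L.clusterGraph.edist (g j) (g w) ≤ k ↔ L'.clusterGraph.edist j w ≤ k) :=
    fun k w hk => e.clusterGraph_edist_iff hj (by omega)
  unfold cluster IsLeader
  simp only [Set.mem_ofPred_eq, e.radii_eq, hid]
  rw [hk _ _ (hr _)]
  refine and_congr (and_congr Iff.rfl ⟨fun h w hw => ?_, fun h w hw => ?_⟩) ?_
  · exact h (g w) ((hk _ _ (hr _)).2 hw)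
  · obtain ⟨w', rfl, hle⟩ := e.exists_lift_of_clusterGraph_edist_le hj
      (by have := hr w; omega) hw
    exact h w' hle
  · rw [ENat.lt_natCast_iff, ENat.lt_natCast_iff]
    refine exists_congr fun n => and_congr_right fun hn => hk n v ?_
    exact hn.le.trans (hr _)

/-- A part that contains the ball of radius `12 * R + 3` around `v₀` determines the clusters of
all leaders within distance `4 * R + 3` of `v₀`: the nodes of such a cluster are within distance
`8 * R + 3`, and every node that could be their leader is within distance `12 * R + 3`. -/
theorem cluster_eq (e : IsLocalPart L' L ident' ident r' r f g v₀ T) (t : Fin ℓ) (hR : 1 ≤ R)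
    (hT : 12 * R + 3 ≤ T) {v : Vd'}
    (hv : L.network.edist v₀ (Sum.inr (g v)) ≤ (4 * R + 3 : ℕ)) :
    (∀ j, j ∈ L.cluster ident (fun j => (r t j : ℕ)) (g v) ↔
      ∃ j' ∈ L'.cluster ident' (fun j => (r' t j : ℕ)) v, g j' = j) ∧
    ∀ i ∈ L.subVars (L.cluster ident (fun j => (r t j : ℕ)) (g v)), i ∈ Set.range f := by
  have hnear : ∀ j, L.clusterGraph.edist j (g v) ≤ R →
      L.network.edist v₀ (Sum.inr j) ≤ (8 * R + 3 : ℕ) := by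
    intro j hj
    rw [SimpleGraph.edist_comm] at hj
    refine (L.edist_of_clusterGraph_edist hv hj).trans ?_
    exact_mod_cast (by omega : 4 * R + 3 + 4 * R ≤ 8 * R + 3)
  have hclR : ∀ j ∈ L.cluster ident (fun j => (r t j : ℕ)) (g v),
      L.clusterGraph.edist j (g v) ≤ R := fun j hj =>
    hj.1.1.trans (by exact_mod_cast Nat.lt_succ_iff.1 (r t (g v)).2)
  have hlift : ∀ u, L.network.edist v₀ u ≤ (8 * R + 4 : ℕ) → u ∈ Set.range (Sum.map f g) :=
    fun u hu => e.ball u (hu.trans (by exact_mod_cast (by omega : 8 * R + 4 ≤ T)))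
  refine ⟨fun j => ⟨fun hj => ?_, ?_⟩, ?_⟩
  · have hd := hnear j (hclR j hj)
    obtain ⟨u, hu⟩ := hlift (Sum.inr j) (hd.trans (by norm_cast; omega))
    rcases u with i | j'
    · simp at hu
    · obtain rfl : g j' = j := by simpa using hu
      exact ⟨j', (e.mem_cluster_iff t hd (by omega)).1 hj, rfl⟩
  · rintro ⟨j', hj', rfl⟩
    have h1 : L'.clusterGraph.edist j' v ≤ R :=
      hj'.1.1.trans (by exact_mod_cast Nat.lt_succ_iff.1 (r' t v).2)
    exact (e.mem_cluster_iff t (hnear _ (e.clusterGraph_edist_map_le h1)) (by omega)).2 hj'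
  · rintro i ⟨j, hj, hA⟩
    have hadj : L.network.Adj (Sum.inr j) (Sum.inl i) := Or.inr ⟨i, j, hA, rfl, rfl⟩
    have hi := SimpleGraph.edist_le_add_natCast (hnear j (hclR j hj))
      (SimpleGraph.edist_le_one_of_adj hadj)
    obtain ⟨u, hu⟩ := hlift (Sum.inl i) hi
    rcases u with i' | j'
    · exact ⟨i', by simpa using hu⟩
    · simp at hu

theorem clusteredPrimal_eq [Fintype Vp] [Fintype Vd] [Fintype Vp'] [Fintype Vd']
    (e : IsLocalPart L' L ident' ident r' r f g v₀ T)
    (hident : Function.Injective ident) (t : Fin ℓ) (hR : 1 ≤ R) (hT : 12 * R + 3 ≤ T) {i : Vp'}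
    (hi : L.network.edist v₀ (Sum.inl (f i)) ≤ (2 : ℕ)) :
    L'.clusteredPrimal ident' r' t i = L.clusteredPrimal ident r t (f i) := by
  have hident' : Function.Injective ident' := by
    have : ident' = ident ∘ Sum.map f g := funext e.ident_eq
    rw [this]
    exact hident.comp (Sum.map_injective.2 ⟨e.f_injective, e.g_injective⟩)
  have hnear : ∀ v j, L.A j (f i) ≠ 0 → L.clusterGraph.edist j v ≤ (r t v : ℕ) →
      L.network.edist v₀ (Sum.inr v) ≤ (4 * R + 3 : ℕ) := by
    intro v j hA hle
    have hadj : L.network.Adj (Sum.inl (f i)) (Sum.inr j) := Or.inl ⟨f i, j, hA, rfl, rfl⟩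
    exact L.edist_leader_le
      (SimpleGraph.edist_le_add_natCast hi (SimpleGraph.edist_le_one_of_adj hadj)) hle
  refine Fintype.sum_of_injective g e.g_injective _ _ (fun v hv => ?_) (fun v => ?_)
  · refine L.chosenPrimal_eq_zero hident (S := L.cluster ident _ v) ?_
    rintro ⟨j, hj, hA⟩
    obtain ⟨u, hu⟩ := e.ball (Sum.inr v) ((hnear v j hA hj.1.1).trans (by norm_cast; omega))
    rcases u with i' | v'
    · simp at hu
    · exact hv ⟨v', by simpa using hu⟩
  · by_cases hv : L.network.edist v₀ (Sum.inr (g v)) ≤ (4 * R + 3 : ℕ)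
    · obtain ⟨hS, hvars⟩ := e.cluster_eq t hR hT hv
      unfold chosenPrimal
      rw [e.primalOptima_eq hident hS hvars, e.ident_eq]
      rfl
    · rw [L.chosenPrimal_eq_zero hident, L'.chosenPrimal_eq_zero hident']
      · rintro ⟨j, hj, hA⟩
        rw [e.A_eq] at hA
        refine hv (hnear (g v) (g j) hA ?_)
        rw [← e.radii_eq]
        exact e.clusterGraph_edist_map_le hj.1.1
      · rintro ⟨j, hj, hA⟩
        exact hv (hnear (g v) j hA hj.1.1)

theorem clusteredDual_eq [Fintype Vd] [Fintype Vd']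
    (e : IsLocalPart L' L ident' ident r' r f g v₀ T)
    (hident : Function.Injective ident) (t : Fin ℓ) (hR : 1 ≤ R) (hT : 12 * R + 3 ≤ T) {j : Vd'}
    (hj : L.network.edist v₀ (Sum.inr (g j)) ≤ (3 : ℕ)) :
    L'.clusteredDual ident' r' t j = L.clusteredDual ident r t (g j) := by
  have hident' : Function.Injective ident' := by
    have : ident' = ident ∘ Sum.map f g := funext e.ident_eq
    rw [this]
    exact hident.comp (Sum.map_injective.2 ⟨e.f_injective, e.g_injective⟩)
  refine Fintype.sum_of_injective g e.g_injective _ _ (fun v hv => ?_) (fun v => ?_)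
  · refine L.chosenDual_eq_zero hident fun hmem => ?_
    obtain ⟨u, hu⟩ := e.ball (Sum.inr v)
      ((L.edist_leader_le hj hmem.1.1).trans (by norm_cast; omega))
    rcases u with i' | v'
    · simp at hu
    · exact hv ⟨v', by simpa using hu⟩
  · by_cases hv : L.network.edist v₀ (Sum.inr (g v)) ≤ (4 * R + 3 : ℕ)
    · obtain ⟨hS, hvars⟩ := e.cluster_eq t hR hT hv
      unfold chosenDual
      rw [e.dualOptima_eq hident hS hvars, e.ident_eq]
      rfl
    · rw [L.chosenDual_eq_zero hident, L'.chosenDual_eq_zero hident']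
      · intro hmem
        refine hv (L.edist_leader_le (t := t) (r := r) hj ?_)
        rw [← e.radii_eq]
        exact e.clusterGraph_edist_map_le hmem.1.1
      · exact fun hmem => hv (L.edist_leader_le hj hmem.1.1)

/-- The canonical output of a node depends only on its neighbourhood of radius `15 * R`; as
`R ≥ 1`, this contains the one of radius `12 * R + 3`. -/
theorem canonicalOutput_eq [Fintype Vp] [Fintype Vd] [Fintype Vp'] [Fintype Vd'] {v : Vp' ⊕ Vd'}
    (e : IsLocalPart L' L ident' ident r' r f g (Sum.map f g v) (15 * R))
    (hident : Function.Injective ident) (hR : 1 ≤ R) :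
    L'.canonicalOutput ident' r' v = L.canonicalOutput ident r (Sum.map f g v) := by
  rcases v with i | j
  · refine e.rescale_eq (x' := fun k => ∑ t, L'.clusteredPrimal ident' r' t k)
      (x := fun k => ∑ t, L.clusteredPrimal ident r t k) (by omega) fun k hk => ?_
    exact Finset.sum_congr rfl fun t _ => e.clusteredPrimal_eq hident t hR (by omega) hk
  · unfold canonicalOutput
    simp only [Sum.map_inr]
    congr 1
    exact Finset.sum_congr rfl fun t _ =>
      e.clusteredDual_eq hident t hR (by omega) (by simp)

end IsLocalPart

end CoveringLP

/-! ### The full-information algorithm -/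

section View

variable {ID : Type} {R ℓ : ℕ}

/-- The identifiers of the primal nodes in a set `K` of (identifier, input) pairs. -/
def KnownPrimal (K : Set (ID × NodeInput ID R ℓ)) : Type :=
  {a : ID // ∃ cost column, (a, NodeInput.primal cost column) ∈ K}

/-- The identifiers of the dual nodes in a set `K` of (identifier, input) pairs. -/
def KnownDual (K : Set (ID × NodeInput ID R ℓ)) : Type :=
  {a : ID // ∃ rhs row radii, (a, NodeInput.dual rhs row radii) ∈ K}

/-- The linear program described by a set of (identifier, input) pairs.  The absolute values only
serve to make the coefficients non-negative for arbitrary `K`. -/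
noncomputable def viewLP (K : Set (ID × NodeInput ID R ℓ)) :
    CoveringLP (KnownPrimal K) (KnownDual K) where
  A j i := |j.2.choose_spec.choose i.1|
  b j := |j.2.choose|
  c i := |i.2.choose|
  A_nonneg _ _ := abs_nonneg _
  b_nonneg _ := abs_nonneg _
  c_nonneg _ := abs_nonneg _

/-- The identifiers of the known nodes. -/
def viewIdent (K : Set (ID × NodeInput ID R ℓ)) : KnownPrimal K ⊕ KnownDual K → ID :=
  Sum.elim Subtype.val Subtype.val

/-- The radii of the known nodes. -/
noncomputable def viewRadii (K : Set (ID × NodeInput ID R ℓ)) (t : Fin ℓ) (j : KnownDual K) :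
    Fin (R + 1) :=
  j.2.choose_spec.choose_spec.choose t

/-- The canonical output of the node with identifier `a` in the linear program described by `K`. -/
noncomputable def viewOutput [LinearOrder ID] (a : ID) (K : Set (ID × NodeInput ID R ℓ)) : ℝ :=
  if h : (Finite (KnownPrimal K) ∧ Finite (KnownDual K)) ∧ ∃ v, viewIdent K v = a then
    haveI := h.1.1
    haveI := h.1.2
    letI := Fintype.ofFinite (KnownPrimal K)
    letI := Fintype.ofFinite (KnownDual K)
    (viewLP K).canonicalOutput (viewIdent K) (viewRadii K) h.2.choose
  else 0

/-- Every node forwards all (identifier, input) pairs that it knows, and finally computes its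
canonical output in the part of the linear program that it has learnt. -/
noncomputable def fullInformation (ID : Type) [LinearOrder ID] (R ℓ : ℕ) :
    LocalAlgorithm ID (NodeInput ID R ℓ) ℝ where
  State := ID × Set (ID × NodeInput ID R ℓ)
  Msg := Set (ID × NodeInput ID R ℓ)
  init a i := (a, {(a, i)})
  send s _ := s.2
  step s M := (s.1, s.2 ∪ {m | ∃ q ∈ M, m ∈ q.2})
  out s := viewOutput s.1 s.2

theorem SimpleGraph.edist_le_succ_iff {V : Type} {G : SimpleGraph V} {u w : V} {k : ℕ} :
    G.edist u w ≤ (k + 1 : ℕ) ↔ G.edist u w ≤ k ∨ ∃ v, G.Adj u v ∧ G.edist v w ≤ k := by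
  constructor
  · intro h
    obtain ⟨p, hp⟩ := SimpleGraph.edist_le_natCast_iff.1 h
    cases p with
    | nil => exact Or.inl (by simp)
    | cons hadj p =>
      exact Or.inr ⟨_, hadj, SimpleGraph.edist_le_natCast_iff.2 ⟨p, by simpa using hp⟩⟩
  · rintro (h | ⟨v, hadj, h⟩)
    · exact h.trans (by norm_cast; omega)
    · rw [add_comm]
      exact SimpleGraph.edist_le_add_natCast (SimpleGraph.edist_le_one_of_adj hadj) h

/-- What the node `v` knows after `T` rounds of the full-information algorithm. -/
def ballView {V I : Type} (G : SimpleGraph V) (ident : V → ID) (inp : V → I) (T : ℕ) (v : V) :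
    Set (ID × I) :=
  {m | ∃ u, G.edist v u ≤ T ∧ m = (ident u, inp u)}

theorem fullInformation_state [LinearOrder ID] {V : Type} (G : SimpleGraph V) (ident : V → ID)
    (inp : V → NodeInput ID R ℓ) (T : ℕ) (v : V) :
    (fullInformation ID R ℓ).state G ident inp T v = (ident v, ballView G ident inp T v) := by
  induction T generalizing v with
  | zero =>
    refine Prod.ext rfl (Set.ext fun m => ?_)
    constructor
    · rintro rfl
      exact ⟨v, by simp, rfl⟩
    · rintro ⟨u, hu, rfl⟩
      obtain rfl : v = u := by simpa using hu
      rfl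
  | succ T ih =>
    have hstep : (fullInformation ID R ℓ).state G ident inp (T + 1) v =
        (ident v, ballView G ident inp T v ∪
          {m | ∃ q ∈ {m | ∃ u, G.Adj v u ∧ m = (ident u, ballView G ident inp T u)}, m ∈ q.2}) := by
      rw [LocalAlgorithm.state]
      simp only [ih]
      rfl
    rw [hstep]
    refine Prod.ext rfl (Set.ext fun m => ?_)
    constructor
    · rintro (⟨u, hu, rfl⟩ | ⟨q, ⟨w, hw, rfl⟩, ⟨u, hu, rfl⟩⟩)
      · exact ⟨u, SimpleGraph.edist_le_succ_iff.2 (Or.inl hu), rfl⟩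
      · exact ⟨u, SimpleGraph.edist_le_succ_iff.2 (Or.inr ⟨w, hw, hu⟩), rfl⟩
    · rintro ⟨u, hu, rfl⟩
      rcases SimpleGraph.edist_le_succ_iff.1 hu with hu | ⟨w, hw, hu⟩
      · exact Or.inl ⟨u, hu, rfl⟩
      · exact Or.inr ⟨_, ⟨w, hw, rfl⟩, ⟨u, hu, rfl⟩⟩

end View

namespace CoveringLP

variable {Vp Vd ID : Type} {R ℓ : ℕ} (L : CoveringLP Vp Vd) {ident : Vp ⊕ Vd → ID}
  (r : Fin ℓ → Vd → Fin (R + 1))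

theorem exists_of_primal_mem_ballView {T : ℕ} {v : Vp ⊕ Vd} {a : ID} {cost : ℝ} {column : ID → ℝ}
    (h : (a, NodeInput.primal cost column) ∈
      ballView L.network ident (L.nodeInput ident r) T v) :
    ∃ i, ident (Sum.inl i) = a ∧ L.c i = cost := by
  obtain ⟨u, -, h⟩ := h
  rcases u with i | j
  · simp only [nodeInput, Prod.mk.injEq, NodeInput.primal.injEq] at h
    exact ⟨i, h.1.symm, h.2.1.symm⟩
  · simp [nodeInput] at h

theorem exists_of_dual_mem_ballView {T : ℕ} {v : Vp ⊕ Vd} {a : ID} {rhs : ℝ} {row : ID → ℝ}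
    {radii : Fin ℓ → Fin (R + 1)}
    (h : (a, NodeInput.dual rhs row radii) ∈
      ballView L.network ident (L.nodeInput ident r) T v) :
    ∃ j, ident (Sum.inr j) = a ∧ L.b j = rhs ∧
      Function.extend (fun i => ident (Sum.inl i)) (fun i => L.A j i) (fun _ => 0) = row ∧
      (fun t => r t j) = radii := by
  obtain ⟨u, -, h⟩ := h
  rcases u with i | j
  · simp [nodeInput] at h
  · simp only [nodeInput, Prod.mk.injEq, NodeInput.dual.injEq] at h
    exact ⟨j, h.1.symm, h.2.1.symm, h.2.2.1.symm, h.2.2.2.symm⟩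

/-- The linear program that a node knows after `T` rounds is a part of the whole one. -/
theorem exists_isLocalPart_viewLP (hident : Function.Injective ident) (T : ℕ) (v : Vp ⊕ Vd) :
    ∃ f g, IsLocalPart (viewLP (ballView L.network ident (L.nodeInput ident r) T v)) L
      (viewIdent _) ident (viewRadii _) r f g v T := by
  set K := ballView L.network ident (L.nodeInput ident r) T v
  have hf : ∀ i : KnownPrimal K, ∃ i₀, ident (Sum.inl i₀) = i.1 ∧ L.c i₀ = i.2.choose :=
    fun i => L.exists_of_primal_mem_ballView r i.2.choose_spec.choose_spec
  have hg : ∀ j : KnownDual K, ∃ j₀, ident (Sum.inr j₀) = j.1 ∧ L.b j₀ = j.2.choose ∧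
      Function.extend (fun i => ident (Sum.inl i)) (fun i => L.A j₀ i) (fun _ => 0) =
        j.2.choose_spec.choose ∧
      (fun t => r t j₀) = j.2.choose_spec.choose_spec.choose :=
    fun j => L.exists_of_dual_mem_ballView r j.2.choose_spec.choose_spec.choose_spec
  choose f hf₁ hf₂ using hf
  choose g hg₁ hg₂ hg₃ hg₄ using hg
  refine ⟨f, g, ⟨fun i i' h => ?_, fun j j' h => ?_, fun j i => ?_, fun j => ?_, fun i => ?_,
    fun u => ?_, fun t j => ?_, fun u hu => ?_⟩⟩
  · exact Subtype.ext (by rw [← hf₁, ← hf₁, h])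
  · exact Subtype.ext (by rw [← hg₁, ← hg₁, h])
  · change |j.2.choose_spec.choose i.1| = _
    rw [← hg₃, ← hf₁]
    have := (hident.comp Sum.inl_injective).extend_apply (fun i => L.A (g j) i) (fun _ => 0) (f i)
    exact (congrArg abs this).trans (abs_of_nonneg (L.A_nonneg _ _))
  · change |j.2.choose| = _
    rw [← hg₂]
    exact abs_of_nonneg (L.b_nonneg _)
  · change |i.2.choose| = _
    rw [← hf₂]
    exact abs_of_nonneg (L.c_nonneg _)
  · rcases u with i | j
    · exact (hf₁ i).symm
    · exact (hg₁ j).symm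
  · exact (congrFun (hg₄ j) t).symm
  · rcases u with i | j
    · have hi : (ident (Sum.inl i), L.nodeInput ident r (Sum.inl i)) ∈ K := ⟨_, hu, rfl⟩
      refine ⟨Sum.inl ⟨ident (Sum.inl i), _, _, hi⟩, ?_⟩
      exact hident (hf₁ _)
    · have hj : (ident (Sum.inr j), L.nodeInput ident r (Sum.inr j)) ∈ K := ⟨_, hu, rfl⟩
      refine ⟨Sum.inr ⟨ident (Sum.inr j), _, _, _, hj⟩, ?_⟩
      exact hident (hg₁ _)

variable [LinearOrder ID] [Fintype Vp] [Fintype Vd]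

theorem viewOutput_eq (hident : Function.Injective ident) (hR : 1 ≤ R) {v : Vp ⊕ Vd}
    {K : Set (ID × NodeInput ID R ℓ)} {f : KnownPrimal K → Vp} {g : KnownDual K → Vd}
    (e : IsLocalPart (viewLP K) L (viewIdent K) ident (viewRadii K) r f g v (15 * R)) :
    viewOutput (ident v) K = L.canonicalOutput ident r v := by
  have hex : ∃ u, viewIdent K u = ident v := by
    obtain ⟨u, hu⟩ := e.ball v (by simp)
    exact ⟨u, by rw [e.ident_eq, hu]⟩
  have hfin : Finite (KnownPrimal K) ∧ Finite (KnownDual K) :=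
    ⟨Finite.of_injective f e.f_injective, Finite.of_injective g e.g_injective⟩
  rw [viewOutput, dif_pos ⟨hfin, hex⟩]
  have hu : Sum.map f g hex.choose = v := hident (by rw [← e.ident_eq]; exact hex.choose_spec)
  generalize hex.choose = u at hu
  subst hu
  have := hfin.1
  have := hfin.2
  let _ := Fintype.ofFinite (KnownPrimal K)
  let _ := Fintype.ofFinite (KnownDual K)
  exact e.canonicalOutput_eq hident hR

/-- After `15 * R` rounds, the full-information algorithm outputs the canonical result. -/
theorem fullInformation_output (hident : Function.Injective ident) (hR : 1 ≤ R) (v : Vp ⊕ Vd) :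
    (fullInformation ID R ℓ).output L.network ident (L.nodeInput ident r) (15 * R) v =
      L.canonicalOutput ident r v := by
  rw [LocalAlgorithm.output, fullInformation_state]
  obtain ⟨f, g, e⟩ := L.exists_isLocalPart_viewLP r hident (15 * R) v
  exact L.viewOutput_eq r hident hR e

end CoveringLP

/-! ### Success probability of one Linial–Saks run -/

theorem measureReal_pi_pi {V Ω : Type} [Fintype V] [MeasurableSpace Ω] (ρ : Measure Ω)
    [IsProbabilityMeasure ρ] (s : V → Set Ω) :
    (Measure.pi fun _ : V => ρ).real (Set.pi Set.univ s) = ∏ v, ρ.real (s v) := by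
  rw [Measure.real, Measure.pi_pi, ENNReal.toReal_prod]
  rfl

theorem radiusPMF_real_singleton (p : unitInterval) (R : ℕ) (k : Fin (R + 1)) :
    (radiusPMF p R).toMeasure.real {k} =
      if (k : ℕ) < R then (p : ℝ) ^ (k : ℕ) * (1 - p) else (p : ℝ) ^ R := by
  have h0 : (0 : ℝ) ≤ p := p.2.1
  have h1 : (0 : ℝ) ≤ 1 - p := sub_nonneg.2 p.2.2
  rw [Measure.real, PMF.toMeasure_apply_singleton _ _ (measurableSet_singleton k)]
  change (ENNReal.ofReal _).toReal = _
  rw [ENNReal.toReal_ofReal]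
  split_ifs <;> positivity

theorem radiusPMF_real_tail (p : unitInterval) {R d : ℕ} (hd : d ≤ R) :
    (radiusPMF p R).toMeasure.real {k | d ≤ (k : ℕ)} = (p : ℝ) ^ d := by
  induction hd using Nat.decreasingInduction with
  | self =>
    have : {k : Fin (R + 1) | R ≤ (k : ℕ)} = {Fin.last R} := by
      ext k
      have := k.2
      simp only [Set.mem_ofPred_eq, Set.mem_singleton_iff, Fin.ext_iff, Fin.val_last]
      omega
    rw [this, radiusPMF_real_singleton]
    simp
  | of_succ d hd ih =>
    have : {k : Fin (R + 1) | d ≤ (k : ℕ)} =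
        {(⟨d, by omega⟩ : Fin (R + 1))} ∪ {k : Fin (R + 1) | d + 1 ≤ (k : ℕ)} := by
      ext k
      simp only [Set.mem_ofPred_eq, Set.mem_union, Set.mem_singleton_iff, Fin.ext_iff]
      omega
    rw [this, measureReal_union ?_ (Set.toFinite _).measurableSet, ih, radiusPMF_real_singleton,
      if_pos hd]
    · ring
    · rw [Set.disjoint_singleton_left]
      simp

section LinialSaks

variable {V ID : Type} [LinearOrder ID] (G : SimpleGraph V) (ident : V → ID) {R : ℕ}
  (u : V)

/-- The radii with which a node `v ≠ w` does not prevent `w` from being the leader of `u`. -/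
def quietRadii (w v : V) : Set (Fin (R + 1)) :=
  if ident w < ident v then {k | ¬ G.edist u v ≤ ((k : ℕ) : ℕ∞)} else Set.univ

/-- The event that `w` is the leader of `u` and has a radius in `a` is a box. -/
theorem setOf_isLeader_and_eq_pi (w : V) {a : Set (Fin (R + 1))}
    (ha : ∀ k ∈ a, G.edist u w ≤ ((k : ℕ) : ℕ∞)) :
    {r : V → Fin (R + 1) | IsLeader G ident (fun v => (r v : ℕ)) w u ∧ r w ∈ a} =
      Set.pi Set.univ (Function.update (quietRadii G ident u w) w a) := by
  ext r
  rw [Set.mem_univ_pi]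
  constructor
  · rintro ⟨h, hw⟩ v
    rcases eq_or_ne v w with rfl | hv
    · simpa using hw
    · rw [Function.update_of_ne hv, quietRadii]
      split_ifs with hlt
      · exact fun hle => absurd (h.2 v hle) (not_le.2 hlt)
      · trivial
  · intro h
    have hw : r w ∈ a := by simpa using h w
    refine ⟨⟨ha _ hw, fun v hle => ?_⟩, hw⟩
    by_contra hlt
    rw [not_le] at hlt
    have hv : v ≠ w := by
      rintro rfl
      exact lt_irrefl _ hlt
    have := h v
    rw [Function.update_of_ne hv, quietRadii, if_pos hlt] at this
    exact this hle

/-- The radius of `w` is independent of the event that no other node prevents `w` from being the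
leader of `u`. -/
theorem measureReal_isLeader_and [Fintype V] (w : V) (ρ : Measure (Fin (R + 1)))
    [IsProbabilityMeasure ρ]
    {a : Set (Fin (R + 1))} (ha : ∀ k ∈ a, G.edist u w ≤ ((k : ℕ) : ℕ∞)) :
    (Measure.pi fun _ : V => ρ).real
        {r | IsLeader G ident (fun v => (r v : ℕ)) w u ∧ r w ∈ a} =
      ρ.real a * ∏ v ∈ Finset.univ \ {w}, ρ.real (quietRadii G ident u w v) := by
  rw [setOf_isLeader_and_eq_pi G ident u w ha, measureReal_pi_pi]
  simp_rw [Function.apply_update (fun _ => ρ.real) (quietRadii G ident u w) w a]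
  exact Finset.prod_update_of_mem (Finset.mem_univ w) _ _

/-- Given that `w` is the leader of `u` at a distance `d < R`, its radius exceeds `d` with
probability `p`, the geometric distribution being memoryless; a leader at a distance `R` has
radius `R`, which has probability `p ^ R`. -/
theorem measureReal_leader_lt_ge [Fintype V] (w : V) (p : unitInterval) :
    (p : ℝ) * ((Measure.pi fun _ : V => (radiusPMF p R).toMeasure).real
        {r | IsLeader G ident (fun v => (r v : ℕ)) w u} - (p : ℝ) ^ R) ≤
      (Measure.pi fun _ : V => (radiusPMF p R).toMeasure).real
        {r | IsLeader G ident (fun v => (r v : ℕ)) w u ∧ G.edist u w < ((r w : ℕ) : ℕ∞)} := by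
  have h0 : (0 : ℝ) ≤ p := p.2.1
  set ρ := (radiusPMF p R).toMeasure with hρ
  set Q := ∏ v ∈ Finset.univ \ {w}, ρ.real (quietRadii G ident u w v) with hQ
  have hQ0 : 0 ≤ Q := Finset.prod_nonneg fun v _ => measureReal_nonneg
  have hQ1 : Q ≤ 1 := Finset.prod_le_one (fun v _ => measureReal_nonneg)
    fun v _ => measureReal_le_one
  have hlead : (Measure.pi fun _ : V => ρ).real
      {r | IsLeader G ident (fun v => (r v : ℕ)) w u} =
      ρ.real {k | G.edist u w ≤ ((k : ℕ) : ℕ∞)} * Q := by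
    rw [hQ, ← measureReal_isLeader_and G ident u w ρ
      (a := {k | G.edist u w ≤ ((k : ℕ) : ℕ∞)}) fun k hk => hk]
    congr 1
    ext r
    exact ⟨fun h => ⟨h, h.1⟩, fun h => h.1⟩
  rw [hlead]
  by_cases hd : G.edist u w < (R : ℕ)
  · have hlt := measureReal_isLeader_and G ident u w ρ
      (a := {k | G.edist u w < ((k : ℕ) : ℕ∞)}) fun k hk => le_of_lt hk
    have hset : {r : V → Fin (R + 1) | IsLeader G ident (fun v => (r v : ℕ)) w u ∧
        G.edist u w < ((r w : ℕ) : ℕ∞)} = {r : V → Fin (R + 1) |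
        IsLeader G ident (fun v => (r v : ℕ)) w u ∧
          r w ∈ {k : Fin (R + 1) | G.edist u w < ((k : ℕ) : ℕ∞)}} := rfl
    rw [hset, hlt, ← hQ]
    generalize G.edist u w = x at hd
    lift x to ℕ using ne_top_of_lt hd
    have hd' : x < R := by exact_mod_cast hd
    have e1 : {k : Fin (R + 1) | (x : ℕ∞) ≤ ((k : ℕ) : ℕ∞)} =
        {k : Fin (R + 1) | x ≤ (k : ℕ)} := by
      ext k
      simp
    have e2 : {k : Fin (R + 1) | (x : ℕ∞) < ((k : ℕ) : ℕ∞)} =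
        {k : Fin (R + 1) | x + 1 ≤ (k : ℕ)} := by
      ext k
      simp
    rw [e1, e2, radiusPMF_real_tail p hd'.le, radiusPMF_real_tail p hd', pow_succ]
    have : 0 ≤ (p : ℝ) * (p : ℝ) ^ R := by positivity
    linarith
  · have hle : ρ.real {k | G.edist u w ≤ ((k : ℕ) : ℕ∞)} ≤ (p : ℝ) ^ R := by
      rw [← radiusPMF_real_tail p le_rfl]
      refine measureReal_mono fun k hk => ?_
      exact_mod_cast (not_lt.1 hd).trans hk
    have : ρ.real {k | G.edist u w ≤ ((k : ℕ) : ℕ∞)} * Q ≤ (p : ℝ) ^ R :=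
      (mul_le_of_le_one_right measureReal_nonneg hQ1).trans hle
    exact (mul_nonpos_of_nonneg_of_nonpos h0 (sub_nonpos.2 this)).trans measureReal_nonneg

variable {ident}

theorem IsLeader.unique (hident : Function.Injective ident) {r : V → ℕ} {u v w : V}
    (hv : IsLeader G ident r v u) (hw : IsLeader G ident r w u) : v = w :=
  hident (le_antisymm (hw.2 v hv.1) (hv.2 w hw.1))

theorem exists_isLeader [Fintype V] (ident : V → ID) (r : V → ℕ) : ∃ w, IsLeader G ident r w u := by
  obtain ⟨w, hw, hmax⟩ := Finset.exists_max_image (Finset.univ.filter fun w => G.edist u w ≤ r w)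
    ident ⟨u, by simp⟩
  exact ⟨w, (Finset.mem_filter.1 hw).2, fun v hv => hmax v (by simpa using hv)⟩

/-- A node is in the set of a Linial–Saks run with probability at least `p * (1 - n * p ^ R)`. -/
theorem measureReal_mem_linialSaks_ge [Fintype V] (hident : Function.Injective ident)
    (p : unitInterval) :
    (p : ℝ) * (1 - (Fintype.card V : ℝ) * (p : ℝ) ^ R) ≤
      (Measure.pi fun _ : V => (radiusPMF p R).toMeasure).real
        {r | u ∈ linialSaks G ident fun v => (r v : ℕ)} := by
  set P := Measure.pi fun _ : V => (radiusPMF p R).toMeasure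
  have hone : ∑ w, P.real {r | IsLeader G ident (fun v => (r v : ℕ)) w u} = 1 := by
    rw [← measureReal_iUnion_fintype ?_ fun w => (Set.toFinite _).measurableSet]
    · have : ⋃ w, {r : V → Fin (R + 1) | IsLeader G ident (fun v => (r v : ℕ)) w u} =
          Set.univ := by
        ext r
        simpa using exists_isLeader G u ident fun v => (r v : ℕ)
      rw [this, probReal_univ]
    · exact fun w w' hne => Set.disjoint_left.2 fun r h h' =>
        hne (IsLeader.unique G hident (r := fun v => (r v : ℕ)) (u := u) h h')
  have hunion : {r : V → Fin (R + 1) | u ∈ linialSaks G ident fun v => (r v : ℕ)} =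
      ⋃ w, {r | IsLeader G ident (fun v => (r v : ℕ)) w u ∧
        G.edist u w < ((r w : ℕ) : ℕ∞)} := by
    ext r
    simp [linialSaks]
  rw [hunion, measureReal_iUnion_fintype ?_ fun w => (Set.toFinite _).measurableSet]
  · refine le_trans (le_of_eq ?_)
      (Finset.sum_le_sum fun w _ => measureReal_leader_lt_ge G ident u w p)
    rw [← Finset.mul_sum, Finset.sum_sub_distrib, hone]
    simp
  · exact fun w w' hne => Set.disjoint_left.2 fun r h h' =>
      hne (IsLeader.unique G hident (r := fun v => (r v : ℕ)) (u := u) h.1 h'.1)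

end LinialSaks

/-! ### A Chernoff bound -/

theorem Real.exp_neg_le_quadratic {ε : ℝ} (hε : 0 ≤ ε) :
    Real.exp (-ε) ≤ 1 - ε + ε ^ 2 / 2 := by
  have h := Real.quadratic_le_exp_of_nonneg hε
  rw [Real.exp_neg, inv_le_iff_one_le_mul₀ (Real.exp_pos ε)]
  have h2 : 0 ≤ 1 - ε + ε ^ 2 / 2 := by nlinarith [sq_nonneg (ε - 1)]
  calc (1 : ℝ) ≤ (1 - ε + ε ^ 2 / 2) * (1 + ε + ε ^ 2 / 2) := by nlinarith [sq_nonneg (ε ^ 2)]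
    _ ≤ (1 - ε + ε ^ 2 / 2) * Real.exp ε := mul_le_mul_of_nonneg_left h h2

/-- Lower tail of the number of successes in `ℓ` independent trials with success probability at
least `q`, from Markov's inequality for `exp (-ε * count)`.  The factor `-ε` in the exponent is
not the optimal one, which is `log (1 - ε)`, but suffices for the bound `exp (-ε² q ℓ / 2)`. -/
theorem measureReal_count_lt_le {Ω : Type} [Finite Ω] [MeasurableSpace Ω]
    [MeasurableSingletonClass Ω] (P : Measure Ω) [IsProbabilityMeasure P] {E : Set Ω} {q ε : ℝ}
    (hq0 : 0 ≤ q) (hq : q ≤ P.real E) (hε : 0 ≤ ε) (ℓ : ℕ) :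
    (Measure.pi fun _ : Fin ℓ => P).real
        {r | ((Finset.univ.filter fun t => r t ∈ E).card : ℝ) < (1 - ε) * q * ℓ} ≤
      Real.exp (-(ε ^ 2 * q * ℓ / 2)) := by
  set μ := Measure.pi fun _ : Fin ℓ => P
  set F : Ω → ℝ := fun ω => if ω ∈ E then Real.exp (-ε) else 1 with hF
  have hprod : ∀ r : Fin ℓ → Ω, ∏ t, F (r t) =
      Real.exp (-(ε * ((Finset.univ.filter fun t => r t ∈ E).card : ℝ))) := by
    intro r
    rw [Finset.prod_ite, Finset.prod_const, Finset.prod_const_one, mul_one, ← Real.exp_nat_mul]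
    congr 1
    ring
  have hint : ∫ ω, F ω ∂P = 1 - P.real E * (1 - Real.exp (-ε)) := by
    have hE : MeasurableSet E := (Set.toFinite _).measurableSet
    have : F = fun ω => 1 - E.indicator (fun _ => 1 - Real.exp (-ε)) ω := by
      funext ω
      by_cases h : ω ∈ E <;> simp [hF, h]
    rw [this, integral_sub (Integrable.of_finite) (Integrable.of_finite),
      integral_indicator_const _ hE]
    simp
  have hle1 : Real.exp (-ε) ≤ 1 := Real.exp_le_one_iff.2 (by linarith)
  have hint0 : 0 ≤ ∫ ω, F ω ∂P := integral_nonneg fun ω => by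
    simp only [hF]
    split_ifs <;> positivity
  have hint1 : ∫ ω, F ω ∂P ≤ Real.exp (-(q * (1 - Real.exp (-ε)))) := by
    rw [hint]
    have h1 := Real.add_one_le_exp (-(q * (1 - Real.exp (-ε))))
    have h2 : q * (1 - Real.exp (-ε)) ≤ P.real E * (1 - Real.exp (-ε)) :=
      mul_le_mul_of_nonneg_right hq (by linarith)
    linarith
  have hmarkov := mul_meas_ge_le_integral_of_nonneg (μ := μ) (f := fun r => ∏ t, F (r t))
    (ae_of_all _ fun r => (Real.exp_pos _).le.trans_eq (hprod r).symm) Integrable.of_finite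
    (Real.exp (-(ε * ((1 - ε) * q * ℓ))))
  have hfub : ∫ r, ∏ t, F (r t) ∂μ = ∏ _t : Fin ℓ, ∫ ω, F ω ∂P :=
    integral_fintype_prod_eq_prod fun (_ : Fin ℓ) (ω : Ω) => F ω
  rw [hfub, Finset.prod_const, Finset.card_univ, Fintype.card_fin] at hmarkov
  have hpow : (∫ ω, F ω ∂P) ^ ℓ ≤ Real.exp (-(ℓ * (q * (1 - Real.exp (-ε))))) := by
    refine (pow_le_pow_left₀ hint0 hint1 ℓ).trans (le_of_eq ?_)
    rw [← Real.exp_nat_mul]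
    congr 1
    ring
  have hsub : μ.real {r | ((Finset.univ.filter fun t => r t ∈ E).card : ℝ) < (1 - ε) * q * ℓ} ≤
      μ.real {r | Real.exp (-(ε * ((1 - ε) * q * ℓ))) ≤ ∏ t, F (r t)} := by
    refine measureReal_mono fun r hr => ?_
    rw [Set.mem_ofPred_eq, hprod, Real.exp_le_exp]
    exact neg_le_neg (mul_le_mul_of_nonneg_left (le_of_lt hr) hε)
  refine hsub.trans ?_
  have h3 := hmarkov.trans hpow
  have h4 : μ.real {r | Real.exp (-(ε * ((1 - ε) * q * ℓ))) ≤ ∏ t, F (r t)} ≤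
      Real.exp (ε * ((1 - ε) * q * ℓ)) * Real.exp (-(ℓ * (q * (1 - Real.exp (-ε))))) := by
    have := mul_le_mul_of_nonneg_left h3 (Real.exp_pos (ε * ((1 - ε) * q * ℓ))).le
    rwa [← mul_assoc, ← Real.exp_add, add_neg_cancel, Real.exp_zero, one_mul] at this
  refine h4.trans ?_
  rw [← Real.exp_add, Real.exp_le_exp]
  have h5 := Real.exp_neg_le_quadratic hε
  have h6 : 0 ≤ q * ℓ := by positivity
  nlinarith [mul_le_mul_of_nonneg_left h5 h6]

/-! ### The approximation guarantee -/

/-- With probability at least `1 - n * exp (-ε² q ℓ / 2)`, every row is in at least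
`(1 - ε) * q * ℓ` of the sets of the `ℓ` runs. -/
theorem CoveringLP.measureReal_forall_count_ge {Vp Vd ID : Type} [Fintype Vd] [LinearOrder ID]
    (L : CoveringLP Vp Vd) {ident : Vp ⊕ Vd → ID} (hident : Function.Injective ident) {R ℓ : ℕ}
    {p : unitInterval} {q ε : ℝ} (hq0 : 0 ≤ q)
    (hq : q = (p : ℝ) * (1 - (Fintype.card Vd : ℝ) * (p : ℝ) ^ R)) (hε : 0 ≤ ε) :
    1 - (Fintype.card Vd : ℝ) * Real.exp (-(ε ^ 2 * q * ℓ / 2)) ≤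
      (radiiMeasure p R ℓ Vd).real {r | ∀ j, (1 - ε) * q * ℓ ≤
        ((Finset.univ.filter fun t => j ∈ L.lsSet ident r t).card : ℝ)} := by
  have : IsProbabilityMeasure (radiiMeasure p R ℓ Vd) := by
    unfold radiiMeasure
    infer_instance
  set bad : Vd → Set (Fin ℓ → Vd → Fin (R + 1)) := fun j =>
    {r | ((Finset.univ.filter fun t => j ∈ L.lsSet ident r t).card : ℝ) < (1 - ε) * q * ℓ}
  have hbad : ∀ j, (radiiMeasure p R ℓ Vd).real (bad j) ≤ Real.exp (-(ε ^ 2 * q * ℓ / 2)) :=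
    fun j => measureReal_count_lt_le _ hq0 (hq.trans_le (measureReal_mem_linialSaks_ge
      L.clusterGraph j (hident.comp Sum.inr_injective) p)) hε ℓ
  have hcompl : {r | ∀ j, (1 - ε) * q * ℓ ≤
      ((Finset.univ.filter fun t => j ∈ L.lsSet ident r t).card : ℝ)} = (⋃ j, bad j)ᶜ := by
    ext r
    simp [bad]
  rw [hcompl, probReal_compl_eq_one_sub (Set.toFinite _).measurableSet]
  have h1 := (measureReal_iUnion_fintype_le (μ := radiiMeasure p R ℓ Vd) bad).trans
    (Finset.sum_le_sum fun j _ => hbad j)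
  simp only [Finset.sum_const, Finset.card_univ, nsmul_eq_mul] at h1
  linarith

theorem mainTheorem7 :
    ∃ C : ℕ, ∀ (ID : Type) [LinearOrder ID] (R ℓ : ℕ), 1 ≤ R →
      ∃ 𝒜 : LocalAlgorithm ID (NodeInput ID R ℓ) ℝ,
        ∀ (Vp Vd : Type) [Fintype Vp] [Fintype Vd] (L : CoveringLP Vp Vd)
          (ident : Vp ⊕ Vd → ID), Function.Injective ident → (∃ x, L.PrimalFeasible x) →
          -- within `C * R` rounds, `𝒜` executes the algorithm, for all outcomes of the radii
          (∀ r : Fin ℓ → Vd → Fin (R + 1),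
            L.IsAlgorithmResult ident r
              (fun i => 𝒜.output L.network ident (L.nodeInput ident r) (C * R) (Sum.inl i))
              (fun j => 𝒜.output L.network ident (L.nodeInput ident r) (C * R) (Sum.inr j))) ∧
          -- the approximation guarantee, whichever optimal solutions of the sub-LPs are used
          ∀ (ε α β q : ℝ) (p : unitInterval), 0 < ε → ε < 1 → 1 < α → 0 < β →
            2 ≤ Fintype.card Vd →
            (p : ℝ) = (Fintype.card Vd : ℝ) ^ (-(α / (R : ℝ))) →
            q = (p : ℝ) * (1 - (Fintype.card Vd : ℝ) * (p : ℝ) ^ R) →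
            2 * (1 + β) / (ε ^ 2 * q) * Real.log (Fintype.card Vd) ≤ (ℓ : ℝ) →
            1 - 1 / (Fintype.card Vd : ℝ) ^ β ≤
              (radiiMeasure p R ℓ Vd).real
                {r | ∀ x y, L.IsAlgorithmResult ident r x y →
                  L.IsPrimalApprox (1 / (q * (1 - ε))) x ∧
                  L.IsDualApprox (1 / (q * (1 - ε))) y} := by
  refine ⟨15, fun ID _ R ℓ hR => ⟨fullInformation ID R ℓ, ?_⟩⟩
  intro Vp Vd _ _ L ident hident hfeas
  refine ⟨fun r => ?_, ?_⟩
  · simp only [L.fullInformation_output r hident hR]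
    exact L.canonicalOutput_isAlgorithmResult hident hfeas r
  · intro ε α β q p hε hε1 hα hβ hn hp hq hℓ
    set n : ℝ := (Fintype.card Vd : ℝ) with hndef
    have hn1 : 1 < n := by
      have : (2 : ℝ) ≤ n := by
        rw [hndef]
        exact_mod_cast hn
      linarith
    have hn0 : 0 < n := by linarith
    have hlog : 0 < Real.log n := Real.log_pos hn1
    have hp0 : 0 < (p : ℝ) := by
      rw [hp]
      exact Real.rpow_pos_of_pos hn0 _
    -- `n * p ^ R = n ^ (1 - α) < 1`
    have hpR : n * (p : ℝ) ^ R < 1 := by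
      have hR' : (R : ℝ) ≠ 0 := by
        have : R ≠ 0 := by omega
        exact_mod_cast this
      have h1 : (p : ℝ) ^ R = n ^ (-α) := by
        rw [hp, ← Real.rpow_natCast, ← Real.rpow_mul hn0.le]
        congr 1
        field_simp
      rw [h1]
      nth_rewrite 1 [← Real.rpow_one n]
      rw [← Real.rpow_add hn0]
      exact Real.rpow_lt_one_of_one_lt_of_neg hn1 (by linarith)
    have hq0 : 0 < q := by
      rw [hq]
      exact mul_pos hp0 (by linarith)
    have hεq : 0 < ε ^ 2 * q := by positivity
    have hℓ0 : (0 : ℝ) < ℓ := lt_of_lt_of_le (by positivity) hℓ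
    have hexp : n * Real.exp (-(ε ^ 2 * q * ℓ / 2)) ≤ 1 / n ^ β := by
      rw [div_mul_eq_mul_div, div_le_iff₀ hεq] at hℓ
      calc n * Real.exp (-(ε ^ 2 * q * ℓ / 2))
          = Real.exp (Real.log n + -(ε ^ 2 * q * ℓ / 2)) := by
            rw [Real.exp_add, Real.exp_log hn0]
        _ ≤ Real.exp (-(Real.log n * β)) := Real.exp_le_exp.2 (by linarith)
        _ = 1 / n ^ β := by
            rw [Real.exp_neg, Real.rpow_def_of_pos hn0, one_div]
    have : IsProbabilityMeasure (radiiMeasure p R ℓ Vd) := by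
      unfold radiiMeasure
      infer_instance
    refine le_trans (by linarith) ((L.measureReal_forall_count_ge (ℓ := ℓ) hident hq0.le hq
      hε.le).trans (measureReal_mono ?_))
    rintro r hr x y ⟨xs, ys, hxs, hys, hx, hy⟩
    obtain rfl : x = _ := funext hx
    obtain rfl : y = _ := funext hy
    rw [mul_comm q]
    exact L.approx_of_count (by exact_mod_cast hℓ0) (mul_pos (by linarith) hq0) hr hxs hys
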